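/- Let $n\ge 2$ and let $\pi_n:\mathbb C^n\to\mathbb C^n$, $\pi_n(z)=(s_1(z),\dots,s_{n-1}(z),p(z))$, where $s_i(z)$ is the $i$-th elementary symmetric polynomial of $z_1,\dots,z_n$ and $p(z)=z_1\cdots z_n$. Put $\Gamma_n=\pi_n(\overline{\mathbb D}^n)$ and $b\Gamma_n=\pi_n(\mathbb T^n)$; for $n=1$ this reads $\Gamma_1=\overline{\mathbb D}$. All operators are bounded and act on complex Hilbert spaces, and $\sigma_T$ denotes the Taylor joint spectrum. A tuple $\underline T=(T_1,\dots,T_k)$ of commuting operators is called - a $\Gamma_k$-contraction if $\sigma_T(\underline T)\subseteq\Gamma_k$ and $\|p(\underline T)q(\underline T)^{-1}\|\le\sup_{\Gamma_k}|p/q|$ for all polynomials $p,q$ in $k$ variables such that $q$ has no zero in $\Gamma_k$; - a $\Gamma_k$-unitary if $T_1,\dots,T_k$ are normal and $\sigma_T(\underline T)\subseteq b\Gamma_k$; - a $\Gamma_k$-isometry if it is the restriction of a $\Gamma_k$-unitary, acting on a Hilbert space $\mathcal K\supseteq\mathcal H$, to the common invariant subspace $\mathcal H$; - a pure $\Gamma_k$-isometry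 if it is a $\Gamma_k$-isometry and $T_k$ is a pure isometry, that is, an isometry with $T_k^{*r}\to0$ strongly as $r\to\infty$. For operators $S_1,\dots,S_{n-1},P$ and $1\le i\le n-1$ let $$\Phi_i(S_1,\dots,S_{n-1},P)=(n-S_i)^*(n-S_i)-(nP-S_{n-i})^*(nP-S_{n-i}).$$ **Theorem.** Let $S_1,\dots,S_{n-1},P$ be commuting operators on a Hilbert space $\mathcal H$. The following are equivalent: 1. $(S_1,\dots,S_{n-1},P)$ is a $\Gamma_n$-isometry. 2. $P$ is an isometry, $S_i=S_{n-i}^*P$ for each $i=1,\dots,n-1$, and $\left(\frac{n-1}{n}S_1,\frac{n-2}{n}S_2,\dots,\frac1nS_{n-1}\right)$ is a $\Gamma_{n-1}$-contraction. 3. (Wold decomposition) There is an orthogonal decomposition $\mathcal H=\mathcal H_1\oplus\mathcal H_2$ into closed common invariant subspaces of $S_1,\dots,S_{n-1},P$ such that $(S_1|_{\mathcal H_1},\dots,S_{n-1}|_{\mathcal H_1},P|_{\mathcal H_1})$ is a $\Gamma_n$-unitary and $(S_1|_{\mathcal H_2},\dots,S_{n-1}|_{\mathcal H_2},P|_{\mathcal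 H_2})$ is a pure $\Gamma_n$-isometry (either summand may be $\{0\}$). 4. $(S_1,\dots,S_{n-1},P)$ is a $\Gamma_n$-contraction and $P$ is an isometry. 5. $\left(\frac{n-1}{n}S_1,\dots,\frac1nS_{n-1}\right)$ is a $\Gamma_{n-1}$-contraction and $\Phi_i(\omega S_1,\omega^2S_2,\dots,\omega^{n-1}S_{n-1},\omega^nP)=0$ for all $\omega\in\mathbb T$ and all $i=1,\dots,n-1$. Moreover, if the spectral radius $r(S_i)$ is less than $n$ for each $i=1,\dots,n-1$, then all of the above are equivalent to: 6. $\left(\frac{n-1}{n}S_1,\dots,\frac1nS_{n-1}\right)$ is a $\Gamma_{n-1}$-contraction and, for each $i=1,\dots,n-1$, $(n\beta P-S_{n-i})(n-\beta S_i)^{-1}$ is an isometry for all $\beta\in\mathbb T$. -/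

import Mathlib

open scoped TensorProduct

noncomputable section

namespace SymPolydisc

universe u

/-! ### The symmetrized polydisc -/

/-- The symmetrization map `π_n : ℂⁿ → ℂⁿ`. The coordinate with index `i : Fin n` is the elementary
symmetric polynomial of degree `i + 1`, so that the coordinates are `s₁, …, s_{n-1}, p` in this
order. -/
def symMap (n : ℕ) (z : Fin n → ℂ) (i : Fin n) : ℂ :=
  ∑ A ∈ Finset.powersetCard ((i : ℕ) + 1) (Finset.univ : Finset (Fin n)), ∏ k ∈ A, z k

/-- The closed symmetrized polydisc `Γ_n = π_n(𝔻̄ⁿ)`. -/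
def Gam (n : ℕ) : Set (Fin n → ℂ) :=
  symMap n '' {z | ∀ k, ‖z k‖ ≤ 1}

/-- The distinguished boundary `bΓ_n = π_n(𝕋ⁿ)`. -/
def bGam (n : ℕ) : Set (Fin n → ℂ) :=
  symMap n '' {z | ∀ k, ‖z k‖ = 1}

section Operators

variable {H : Type u} [NormedAddCommGroup H] [InnerProductSpace ℂ H]

/-! ### The Taylor joint spectrum -/

/-- The Koszul differential `D_T = ∑ i, T_i ⊗ E_i` on `H ⊗ Λ(ℂⁿ)`, where `E_i ξ = e_i ∧ ξ`. -/
def koszulMap {n : ℕ} (T : Fin n → H →L[ℂ] H) :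
    (H ⊗[ℂ] ExteriorAlgebra ℂ (Fin n → ℂ)) →ₗ[ℂ] (H ⊗[ℂ] ExteriorAlgebra ℂ (Fin n → ℂ)) :=
  ∑ i, TensorProduct.map (T i : H →ₗ[ℂ] H)
    (LinearMap.mulLeft ℂ (ExteriorAlgebra.ι ℂ (Pi.single i (1 : ℂ) : Fin n → ℂ)))

/-- A (commuting) tuple is non-singular if `Ran D_T = Ker D_T`. -/
def IsNonsingular {n : ℕ} (T : Fin n → H →L[ℂ] H) : Prop :=
  LinearMap.range (koszulMap T) = LinearMap.ker (koszulMap T)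

/-- The Taylor joint spectrum of a (commuting) tuple. -/
def taylorSpectrum {n : ℕ} (T : Fin n → H →L[ℂ] H) : Set (Fin n → ℂ) :=
  {μ | ¬ IsNonsingular (fun i => T i - μ i • ContinuousLinearMap.id ℂ H)}

/-! ### Spectral sets -/

/-- The operator `p(T₁, …, T_n)` for a polynomial `p` and a commuting tuple `T`. -/
def polyEval {n : ℕ} (T : Fin n → H →L[ℂ] H) (p : MvPolynomial (Fin n) ℂ) : H →L[ℂ] H :=
  ∑ m ∈ p.support, p.coeff m • (List.ofFn fun i => T i ^ m i).prod

/-- The compact set `X ⊆ ℂⁿ` is a spectral set for the commuting tuple `T`: the Taylor joint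
spectrum lies in `X`, and `‖p(T) q(T)⁻¹‖ ≤ sup_X |p / q|` for all polynomials `p`, `q` such that
`q` has no zero in `X`. (By the spectral mapping theorem the first condition makes `q(T)`
invertible for these `q`, so `Ring.inverse` is the true inverse.) -/
def IsSpectralSet {n : ℕ} (X : Set (Fin n → ℂ)) (T : Fin n → H →L[ℂ] H) : Prop :=
  taylorSpectrum T ⊆ X ∧
  ∀ p q : MvPolynomial (Fin n) ℂ, (∀ x ∈ X, MvPolynomial.eval x q ≠ 0) →
    ‖polyEval T p * Ring.inverse (polyEval T q)‖ ≤
      sSup ((fun x => ‖MvPolynomial.eval x p / MvPolynomial.eval x q‖) '' X)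

/-! ### Classes of operator tuples -/

/-- A `Γ_n`-contraction: a commuting tuple having `Γ_n` as a spectral set. -/
def IsGamContraction {n : ℕ} (T : Fin n → H →L[ℂ] H) : Prop :=
  (∀ i j, Commute (T i) (T j)) ∧ IsSpectralSet (Gam n) T

/-- A `Γ_n`-unitary: a commuting tuple of normal operators whose Taylor joint spectrum lies in
`bΓ_n`. -/
def IsGamUnitary [CompleteSpace H] {n : ℕ} (T : Fin n → H →L[ℂ] H) : Prop :=
  (∀ i j, Commute (T i) (T j)) ∧ (∀ i, IsStarNormal (T i)) ∧ taylorSpectrum T ⊆ bGam n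

/-- A `Γ_n`-isometry: the restriction of a `Γ_n`-unitary `N` on a Hilbert space `K` containing `H`
(through the isometric embedding `V`) to the common invariant subspace `H`. -/
def IsGamIsometry {n : ℕ} (T : Fin n → H →L[ℂ] H) : Prop :=
  ∃ (K : Type u) (_ : NormedAddCommGroup K) (_ : InnerProductSpace ℂ K) (_ : CompleteSpace K)
    (V : H →ₗᵢ[ℂ] K) (N : Fin n → K →L[ℂ] K),
    IsGamUnitary N ∧ ∀ i x, N i (V x) = V (T i x)

/-- A pure isometry: an isometry `P` with `P*ᵏ → 0` strongly. -/
def IsPureIsometry [CompleteSpace H] (P : H →L[ℂ] H) : Prop :=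
  Isometry P ∧
    ∀ x : H, Filter.Tendsto (fun k : ℕ => ((ContinuousLinearMap.adjoint P) ^ k) x)
      Filter.atTop (nhds 0)

/-- A pure `Γ_{m+1}`-isometry: a `Γ_{m+1}`-isometry whose last entry is a pure isometry. -/
def IsPureGamIsometry [CompleteSpace H] {m : ℕ} (T : Fin (m + 1) → H →L[ℂ] H) : Prop :=
  IsGamIsometry T ∧ IsPureIsometry (T (Fin.last m))

/-- `T` is the orthogonal direct sum, with respect to `H = H₁ ⊕ H₁ᗮ`, of a `Γ_{m+1}`-unitary and a
pure `Γ_{m+1}`-isometry. Completeness of `H₁` says that it is a closed subspace. -/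
def HasWoldDecomposition [CompleteSpace H] {m : ℕ} (T : Fin (m + 1) → H →L[ℂ] H) : Prop :=
  ∃ (H₁ : Submodule ℂ H) (_ : CompleteSpace H₁)
    (h₁ : ∀ i, Set.MapsTo (T i) H₁ H₁) (h₂ : ∀ i, Set.MapsTo (T i) H₁ᗮ H₁ᗮ),
    IsGamUnitary (fun i => (T i).restrict (h₁ i)) ∧
    IsPureGamIsometry (fun i => (T i).restrict (h₂ i))

/-! ### Tuples `(S₁, …, S_{n-1}, P)` with `n = m + 1`

`S : Fin m → _` lists `S₁, …, S_m`: the entry `S j` is `S_{j+1}`, and if `S j` is `S_i` then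
`S j.rev` is `S_{n-i}`. -/

/-- The tuple `(S₁, …, S_{n-1}, P)`, `n = m + 1`. -/
def joinTuple {m : ℕ} (S : Fin m → H →L[ℂ] H) (P : H →L[ℂ] H) : Fin (m + 1) → H →L[ℂ] H :=
  Fin.snoc (α := fun _ => H →L[ℂ] H) S P

/-- The scaled tuple `((n-1)/n S₁, (n-2)/n S₂, …, 1/n S_{n-1})`, `n = m + 1`. -/
def scaledTuple {m : ℕ} (S : Fin m → H →L[ℂ] H) : Fin m → H →L[ℂ] H :=
  fun j => (((m : ℂ) - (j : ℕ)) / ((m : ℂ) + 1)) • S j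

/-- The operator pencil
`Φ_i(S₁, …, S_{n-1}, P) = (n - S_i)* (n - S_i) - (n P - S_{n-i})* (n P - S_{n-i})`, where
`n = m + 1` and `i = j + 1`. -/
def pencil [CompleteSpace H] {m : ℕ} (S : Fin m → H →L[ℂ] H) (P : H →L[ℂ] H) (j : Fin m) :
    H →L[ℂ] H :=
  star (((m : ℂ) + 1) • (1 : H →L[ℂ] H) - S j) * (((m : ℂ) + 1) • (1 : H →L[ℂ] H) - S j)
    - star (((m : ℂ) + 1) • P - S j.rev) * (((m : ℂ) + 1) • P - S j.rev)

/-- All pencils `Φ_i(ω S₁, ω² S₂, …, ω^{n-1} S_{n-1}, ωⁿ P)` vanish for all `ω` on the unit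
circle. -/
def PencilsVanish [CompleteSpace H] {m : ℕ} (S : Fin m → H →L[ℂ] H) (P : H →L[ℂ] H) : Prop :=
  ∀ ω : ℂ, ‖ω‖ = 1 → ∀ j : Fin m,
    pencil (fun k => ω ^ ((k : ℕ) + 1) • S k) (ω ^ (m + 1) • P) j = 0

end Operators

end SymPolydisc

end

/-! Condition 2 is the hub: every other condition is compared with it or with condition 1.

Commuting normal operators lie in a commutative C⋆-algebra, where the values of the characters
belong to the Taylor spectrum and any set containing all these values contains the Taylor spectrum
(`character_mem_taylorSpectrum`, `taylorSpectrum_subset_of_character`). Statements on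
`Γ_n`-unitaries thus become pointwise statements on `bΓ_n`. A point of `ℂⁿ` codes a monic polynomial
`f` of degree `n`, and the scaled point codes `f' / n`. Gauss–Lucas gives `scaleVec_mem_Gam`;
conversely, if `|p| = 1`, `s_i = conj(s_{n-i}) p` and the scaled point is in `Γ_{n-1}`, then Cohn's
theorem puts all zeros of `f` on the circle (`mem_bGam_of_scaleVec`).

1 → 2, 4: identities and rational bounds hold on characters and pass to restrictions. Since `Γ_n` is
polynomially convex (`polyConvex_Gam`), polynomial bounds alone locate the Taylor spectrum.

2 → 1: the minimal unitary extension of `P` carries a contractive homomorphic extension of the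
commutant of `P` that preserves the relations (`exists_unitary_extension`); Cohn's theorem on
characters makes the extended tuple a `Γ_n`-unitary (`isGamUnitary_joinTuple`).

4 → 2: near `p`, some polynomials have modulus `1 + O(ε²)` on `bΓ_n`; since `P` is isometric, the
first-order term of the von Neumann inequality must vanish (`eq_adjoint_mul_of_polyBounded`).

1 ↔ 3: the Wold decomposition of `P` reduces each `S_i` because `S_i* = P* S_{n-i}`; conversely,
condition 2 survives orthogonal sums.

2 ↔ 5, 6: expanded in `β` on the circle, the pencil has the Fourier coefficients `n²(1 - P*P) +
S_i*S_i - S_{n-i}*S_{n-i}` and, up to the factor `n`, `S_{n-i}*P - S_i` and its adjoint. All vanish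
exactly when `P` is an isometry and the relations hold. -/

open scoped TensorProduct

noncomputable section

namespace SymPolydisc

universe u

/-! ### The Koszul complex: homotopies and exactness in low degrees. -/

section
variable {H : Type u} [NormedAddCommGroup H] [InnerProductSpace ℂ H]

/-- The Koszul differential on elementary tensors. -/
theorem koszulMap_tmul {n : ℕ} (T : Fin n → H →L[ℂ] H) (x : H)
    (ξ : ExteriorAlgebra ℂ (Fin n → ℂ)) :
    koszulMap T (x ⊗ₜ ξ) =
      ∑ i, (T i x) ⊗ₜ[ℂ] (ExteriorAlgebra.ι ℂ (Pi.single i (1 : ℂ) : Fin n → ℂ) * ξ) := by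
  simp [koszulMap, LinearMap.sum_apply]

theorem ι_mul_ι_mul_swap {M : Type*} [AddCommGroup M] [Module ℂ M] (v w : M)
    (ξ : ExteriorAlgebra ℂ M) :
    ExteriorAlgebra.ι ℂ v * (ExteriorAlgebra.ι ℂ w * ξ) =
      -(ExteriorAlgebra.ι ℂ w * (ExteriorAlgebra.ι ℂ v * ξ)) := by
  rw [← mul_assoc, ← mul_assoc, ← neg_mul]
  congr 1
  exact eq_neg_of_add_eq_zero_left (ExteriorAlgebra.ι_add_mul_swap v w)

/-- In the double sum the operators commute while the exterior generators anticommute, so exchanging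
the two indices changes the sign. -/
theorem koszulMap_koszulMap {n : ℕ} (T : Fin n → H →L[ℂ] H)
    (hT : ∀ i j, Commute (T i) (T j)) (ξ : H ⊗[ℂ] ExteriorAlgebra ℂ (Fin n → ℂ)) :
    koszulMap T (koszulMap T ξ) = 0 := by
  induction ξ using TensorProduct.induction_on with
  | zero => simp
  | add a b ha hb => simp [ha, hb]
  | tmul x ξ =>
    have key : koszulMap T (koszulMap T (x ⊗ₜ ξ)) = -koszulMap T (koszulMap T (x ⊗ₜ ξ)) := by
      rw [koszulMap_tmul, map_sum]
      simp_rw [koszulMap_tmul]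
      conv_lhs => rw [Finset.sum_comm]
      rw [← Finset.sum_neg_distrib]
      refine Finset.sum_congr rfl fun i _ => ?_
      rw [← Finset.sum_neg_distrib]
      refine Finset.sum_congr rfl fun j _ => ?_
      have hx : T i (T j x) = T j (T i x) :=
        congrArg (fun A : H →L[ℂ] H => A x) (hT i j).eq
      rw [ι_mul_ι_mul_swap (Pi.single i 1), TensorProduct.tmul_neg, hx]
    have h2 : (2 : ℂ) • koszulMap T (koszulMap T (x ⊗ₜ ξ)) = 0 := by
      rw [two_smul]
      nth_rewrite 1 [key]
      simp
    exact (smul_eq_zero.mp h2).resolve_left two_ne_zero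

/-- The homotopy of the Koszul complex given by operators `B`. -/
def koszulHomotopy {n : ℕ} (B : Fin n → H →L[ℂ] H) :
    (H ⊗[ℂ] ExteriorAlgebra ℂ (Fin n → ℂ)) →ₗ[ℂ] (H ⊗[ℂ] ExteriorAlgebra ℂ (Fin n → ℂ)) :=
  ∑ i, TensorProduct.map (B i : H →ₗ[ℂ] H)
    (CliffordAlgebra.contractLeft (Q := (0 : QuadraticForm ℂ (Fin n → ℂ))) (LinearMap.proj i))

theorem contractLeft_proj_ι_mul {n : ℕ} (i j : Fin n) (ξ : ExteriorAlgebra ℂ (Fin n → ℂ)) :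
    CliffordAlgebra.contractLeft (Q := (0 : QuadraticForm ℂ (Fin n → ℂ))) (LinearMap.proj i)
      (ExteriorAlgebra.ι ℂ (Pi.single j (1 : ℂ) : Fin n → ℂ) * ξ) =
    (if i = j then ξ else 0) - ExteriorAlgebra.ι ℂ (Pi.single j (1 : ℂ) : Fin n → ℂ) *
      CliffordAlgebra.contractLeft (Q := (0 : QuadraticForm ℂ (Fin n → ℂ)))
        (LinearMap.proj i) ξ := by
  have := CliffordAlgebra.contractLeft_ι_mul (Q := (0 : QuadraticForm ℂ (Fin n → ℂ)))
    (LinearMap.proj i) (Pi.single j (1 : ℂ)) ξ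
  refine this.trans ?_
  congr 1
  by_cases h : i = j <;> simp [h]

theorem koszulHomotopy_tmul {n : ℕ} (B : Fin n → H →L[ℂ] H) (x : H)
    (ξ : ExteriorAlgebra ℂ (Fin n → ℂ)) :
    koszulHomotopy B (x ⊗ₜ ξ) = ∑ i, (B i x) ⊗ₜ[ℂ]
      (CliffordAlgebra.contractLeft (Q := (0 : QuadraticForm ℂ (Fin n → ℂ)))
        (LinearMap.proj i) ξ : ExteriorAlgebra ℂ (Fin n → ℂ)) := by
  simp [koszulHomotopy, LinearMap.sum_apply]

/-- Cartan's formula: contraction is an antiderivation, so the mixed terms cancel and only the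
diagonal `∑ B i * A i` survives. -/
theorem koszul_homotopy {n : ℕ} (A B : Fin n → H →L[ℂ] H)
    (hAB : ∀ i j, Commute (B i) (A j)) (h1 : ∑ i, B i * A i = 1)
    (ξ : H ⊗[ℂ] ExteriorAlgebra ℂ (Fin n → ℂ)) :
    koszulMap A (koszulHomotopy B ξ) + koszulHomotopy B (koszulMap A ξ) = ξ := by
  induction ξ using TensorProduct.induction_on with
  | zero => simp
  | add a b ha hb =>
    rw [map_add, map_add, map_add, map_add, add_add_add_comm, ha, hb]
  | tmul x ξ =>
    rw [koszulMap_tmul, koszulHomotopy_tmul, map_sum, map_sum]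
    simp_rw [koszulMap_tmul, koszulHomotopy_tmul, contractLeft_proj_ι_mul, TensorProduct.tmul_sub,
      Finset.sum_sub_distrib]
    have e1 : ∀ i j, A j (B i x) = B i (A j x) := fun i j =>
      (congrArg (fun A : H →L[ℂ] H => A x) (hAB i j).eq).symm
    simp_rw [e1]
    rw [Finset.sum_comm, add_sub_cancel]
    have : ∀ j i : Fin n, (B i (A j x)) ⊗ₜ[ℂ] (if i = j then ξ else 0) =
        if i = j then (B i (A j x)) ⊗ₜ[ℂ] ξ else 0 := by
      intro j i; split_ifs <;> simp
    simp_rw [this]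
    simp only [Finset.sum_ite_eq', Finset.mem_univ, if_true]
    rw [← TensorProduct.sum_tmul]
    congr 1
    have := congrArg (fun A : H →L[ℂ] H => A x) h1
    simpa using this

/-- A commuting tuple which generates the unit ideal in its commutant is non-singular. -/
theorem isNonsingular_of_sum_mul_eq_one {n : ℕ} (A B : Fin n → H →L[ℂ] H)
    (hA : ∀ i j, Commute (A i) (A j)) (hAB : ∀ i j, Commute (B i) (A j))
    (h1 : ∑ i, B i * A i = 1) : IsNonsingular A := by
  refine le_antisymm ?_ fun ξ hξ => ?_
  · rintro _ ⟨ξ, rfl⟩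
    exact koszulMap_koszulMap A hA ξ
  · refine ⟨koszulHomotopy B ξ, ?_⟩
    have := koszul_homotopy A B hAB h1 ξ
    rwa [LinearMap.mem_ker.mp hξ, map_zero, add_zero] at this

/-- The degree zero part of an element of the Koszul complex. -/
def koszulDegZero (H : Type u) [NormedAddCommGroup H] [InnerProductSpace ℂ H] (n : ℕ) :
    (H ⊗[ℂ] ExteriorAlgebra ℂ (Fin n → ℂ)) →ₗ[ℂ] H :=
  (TensorProduct.rid ℂ H).toLinearMap ∘ₗ TensorProduct.map LinearMap.id
    (ExteriorAlgebra.algebraMapInv (R := ℂ) (M := Fin n → ℂ)).toLinearMap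

theorem koszulDegZero_tmul {n : ℕ} (x : H) (ξ : ExteriorAlgebra ℂ (Fin n → ℂ)) :
    koszulDegZero H n (x ⊗ₜ ξ) = ExteriorAlgebra.algebraMapInv ξ • x := by
  simp [koszulDegZero]

theorem koszulDegZero_koszulMap {n : ℕ} (A : Fin n → H →L[ℂ] H)
    (ξ : H ⊗[ℂ] ExteriorAlgebra ℂ (Fin n → ℂ)) : koszulDegZero H n (koszulMap A ξ) = 0 := by
  induction ξ using TensorProduct.induction_on with
  | zero => simp
  | add a b ha hb => simp [ha, hb]
  | tmul x ξ =>
    simp [koszulMap_tmul, koszulDegZero_tmul, ExteriorAlgebra.algebraMapInv]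

/-- The coefficient at `e i` of the degree one part of an element of the Koszul complex. -/
def koszulDegOne (H : Type u) [NormedAddCommGroup H] [InnerProductSpace ℂ H] {n : ℕ} (i : Fin n) :
    (H ⊗[ℂ] ExteriorAlgebra ℂ (Fin n → ℂ)) →ₗ[ℂ] H :=
  koszulDegZero H n ∘ₗ TensorProduct.map LinearMap.id
    (CliffordAlgebra.contractLeft (Q := (0 : QuadraticForm ℂ (Fin n → ℂ))) (LinearMap.proj i))

theorem koszulDegOne_tmul {n : ℕ} (i : Fin n) (x : H) (ξ : ExteriorAlgebra ℂ (Fin n → ℂ)) :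
    koszulDegOne H i (x ⊗ₜ ξ) = ExteriorAlgebra.algebraMapInv
      (CliffordAlgebra.contractLeft (Q := (0 : QuadraticForm ℂ (Fin n → ℂ)))
        (LinearMap.proj i) ξ : ExteriorAlgebra ℂ (Fin n → ℂ)) • x := by
  rw [koszulDegOne, LinearMap.comp_apply, TensorProduct.map_tmul]
  exact koszulDegZero_tmul _ _

theorem koszulDegOne_koszulMap {n : ℕ} (A : Fin n → H →L[ℂ] H) (i : Fin n)
    (ξ : H ⊗[ℂ] ExteriorAlgebra ℂ (Fin n → ℂ)) :
    koszulDegOne H i (koszulMap A ξ) = A i (koszulDegZero H n ξ) := by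
  induction ξ using TensorProduct.induction_on with
  | zero => simp
  | add a b ha hb => simp [ha, hb]
  | tmul x ξ =>
    rw [koszulMap_tmul, map_sum, koszulDegZero_tmul]
    simp_rw [koszulDegOne_tmul, contractLeft_proj_ι_mul]
    rw [Finset.sum_eq_single i]
    · simp [ExteriorAlgebra.algebraMapInv]
    · intro j _ hj
      simp [ExteriorAlgebra.algebraMapInv, hj.symm]
    · simp

/-- A non-singular commuting tuple is jointly bounded below. -/
theorem IsNonsingular.exists_norm_le [CompleteSpace H] {n : ℕ} {A : Fin n → H →L[ℂ] H}
    (hA : ∀ i j, Commute (A i) (A j)) (h : IsNonsingular A) :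
    ∃ c : NNReal, ∀ x, ‖x‖ ≤ c * ‖fun i => A i x‖ := by
  -- Exactness in degree zero: a common kernel vector would be a boundary of degree zero, and
  -- boundaries have no part of degree zero.
  have inj : Function.Injective (ContinuousLinearMap.pi A) := by
    refine (injective_iff_map_eq_zero _).mpr fun x hx => ?_
    have hx' : ∀ i, A i x = 0 := fun i => congrFun hx i
    have : x ⊗ₜ[ℂ] (1 : ExteriorAlgebra ℂ (Fin n → ℂ)) ∈ LinearMap.ker (koszulMap A) := by
      simp [koszulMap_tmul, hx']
    rw [← h] at this
    obtain ⟨ξ, hξ⟩ := this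
    have h2 := koszulDegZero_koszulMap A ξ
    rw [hξ, koszulDegZero_tmul] at h2
    simpa using h2
  have ran : Set.range (ContinuousLinearMap.pi A) =
      {y : Fin n → H | ∀ i j, A i (y j) = A j (y i)} := by
    ext y
    constructor
    · rintro ⟨x, rfl⟩ i j
      exact congrArg (fun A : H →L[ℂ] H => A x) (hA i j).eq
    · intro hy
      -- Exactness in degree one: a compatible family is a cocycle, and the degree zero part of a
      -- primitive is the vector sought. The range is then cut out by closed conditions.
      have hk : ∑ i, y i ⊗ₜ[ℂ] ExteriorAlgebra.ι ℂ (Pi.single i (1 : ℂ) : Fin n → ℂ) ∈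
          LinearMap.ker (koszulMap A) := by
        rw [LinearMap.mem_ker]
        set η := koszulMap A
          (∑ i, y i ⊗ₜ[ℂ] ExteriorAlgebra.ι ℂ (Pi.single i (1 : ℂ) : Fin n → ℂ)) with hη
        have key : η = -η := by
          rw [hη, map_sum]
          conv_lhs => simp only [koszulMap_tmul]
          conv_rhs => simp only [koszulMap_tmul]
          conv_lhs => rw [Finset.sum_comm]
          rw [← Finset.sum_neg_distrib]
          refine Finset.sum_congr rfl fun i _ => ?_
          rw [← Finset.sum_neg_distrib]
          refine Finset.sum_congr rfl fun j _ => ?_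
          rw [hy i j, eq_neg_of_add_eq_zero_left (ExteriorAlgebra.ι_add_mul_swap (Pi.single i 1) _),
            TensorProduct.tmul_neg]
        have h2 : (2 : ℂ) • η = 0 := by
          rw [two_smul]
          nth_rewrite 1 [key]
          simp
        exact (smul_eq_zero.mp h2).resolve_left two_ne_zero
      rw [← h] at hk
      obtain ⟨ξ, hξ⟩ := hk
      refine ⟨koszulDegZero H n ξ, funext fun i => ?_⟩
      have h2 := koszulDegOne_koszulMap A i ξ
      rw [hξ, map_sum] at h2
      rw [ContinuousLinearMap.pi_apply, ← h2, Finset.sum_eq_single i]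
      · rw [koszulDegOne_tmul, ← mul_one (ExteriorAlgebra.ι ℂ _), contractLeft_proj_ι_mul]
        simp [ExteriorAlgebra.algebraMapInv]
      · intro j _ hj
        rw [koszulDegOne_tmul, ← mul_one (ExteriorAlgebra.ι ℂ _), contractLeft_proj_ι_mul]
        simp [ExteriorAlgebra.algebraMapInv, hj.symm]
      · simp
  have closed : IsClosed (Set.range (ContinuousLinearMap.pi A)) := by
    rw [ran]
    simp only [Set.ofPred_forall]
    refine isClosed_iInter fun i => isClosed_iInter fun j => ?_
    exact isClosed_eq (by fun_prop) (by fun_prop)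
  obtain ⟨c, hc⟩ :=
    (ContinuousLinearMap.pi A).antilipschitz_of_injective_of_isClosed_range inj closed
  refine ⟨c, fun x => ?_⟩
  have := hc.le_mul_dist x 0
  rw [map_zero, dist_zero_right, dist_zero_right] at this
  exact this

end

/-! ### Polynomials in commuting operators and the Taylor spectrum. -/

section PolyEval
variable {H : Type u} [NormedAddCommGroup H] [InnerProductSpace ℂ H]

/-- `polyEval` is the evaluation homomorphism of any commutative algebra mapping to the tuple. -/
theorem polyEval_eq_aeval {A : Type*} [CommRing A] [Algebra ℂ A] (f : A →ₐ[ℂ] (H →L[ℂ] H))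
    {n : ℕ} (a : Fin n → A) (p : MvPolynomial (Fin n) ℂ) :
    polyEval (fun i => f (a i)) p = f (MvPolynomial.aeval a p) := by
  rw [MvPolynomial.aeval_def, MvPolynomial.eval₂_eq', map_sum]
  refine Finset.sum_congr rfl fun m _ => ?_
  rw [← Algebra.smul_def, map_smul, ← List.prod_ofFn, map_list_prod, List.map_ofFn]
  congr 2
  simp [Function.comp_def]

open scoped IsMulCommutative in
/-- The evaluation homomorphism of a commuting tuple. -/
theorem exists_polyEval_hom {n : ℕ} {T : Fin n → H →L[ℂ] H} (hT : ∀ i j, Commute (T i) (T j)) :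
    ∃ f : MvPolynomial (Fin n) ℂ →ₐ[ℂ] (H →L[ℂ] H), (∀ i, f (MvPolynomial.X i) = T i) ∧
      ∀ p, polyEval T p = f p := by
  have hc : IsMulCommutative (Algebra.adjoin ℂ (Set.range T)) :=
    Algebra.isMulCommutative_adjoin ℂ (by rintro _ ⟨i, rfl⟩ _ ⟨j, rfl⟩; exact hT i j)
  let a : Fin n → Algebra.adjoin ℂ (Set.range T) := fun i =>
    ⟨T i, Algebra.subset_adjoin ⟨i, rfl⟩⟩
  let v : Algebra.adjoin ℂ (Set.range T) →ₐ[ℂ] (H →L[ℂ] H) := Subalgebra.val _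
  refine ⟨v.comp (MvPolynomial.aeval a), fun i => ?_, fun p => ?_⟩
  · simp [v, a]
  · exact polyEval_eq_aeval v a p

/-- Polynomials in intertwined commuting tuples are intertwined. -/
theorem polyEval_intertwine {K : Type*} [NormedAddCommGroup K] [InnerProductSpace ℂ K] {n : ℕ}
    {T : Fin n → H →L[ℂ] H} {N : Fin n → K →L[ℂ] K} (hT : ∀ i j, Commute (T i) (T j))
    (hN : ∀ i j, Commute (N i) (N j)) (V : H →ₗ[ℂ] K) (h : ∀ i x, N i (V x) = V (T i x))
    (p : MvPolynomial (Fin n) ℂ) (x : H) : polyEval N p (V x) = V (polyEval T p x) := by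
  obtain ⟨f, hf, hf'⟩ := exists_polyEval_hom hT
  obtain ⟨g, hg, hg'⟩ := exists_polyEval_hom hN
  rw [hf', hg']
  induction p using MvPolynomial.induction_on generalizing x with
  | C a =>
    rw [← MvPolynomial.algebraMap_eq, AlgHom.commutes, AlgHom.commutes]
    simp [Algebra.algebraMap_eq_smul_one]
  | add p q hp hq => simp [hp, hq]
  | mul_X p i hp => simp [hp, hf, hg, h]

theorem polyEval_one {n : ℕ} (T : Fin n → H →L[ℂ] H) : polyEval T 1 = 1 := by
  have : (1 : MvPolynomial (Fin n) ℂ).support = {0} := by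
    rw [← MvPolynomial.C_1, MvPolynomial.C_apply, MvPolynomial.support_monomial]
    simp
  rw [polyEval, this, Finset.sum_singleton]
  simp

/-- An operator commuting with a tuple commutes with the polynomials in the tuple. -/
theorem commute_polyEval {n : ℕ} {T : Fin n → H →L[ℂ] H} (hT : ∀ i j, Commute (T i) (T j))
    {A : H →L[ℂ] H} (hA : ∀ i, Commute A (T i)) (p : MvPolynomial (Fin n) ℂ) :
    Commute A (polyEval T p) := by
  refine ContinuousLinearMap.ext fun x => ?_
  exact (polyEval_intertwine hT hT (A : H →ₗ[ℂ] H)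
    (fun i y => (congrArg (fun B : H →L[ℂ] H => B y) (hA i).eq).symm) p x).symm

/-- Membership of `p - p(μ)` in the ideal generated by the `X i - μ i`, for operators. -/
theorem exists_polyEval_sub {n : ℕ} (T : Fin n → H →L[ℂ] H) (hT : ∀ i j, Commute (T i) (T j))
    (μ : Fin n → ℂ) (p : MvPolynomial (Fin n) ℂ) :
    ∃ g : Fin n → MvPolynomial (Fin n) ℂ,
      polyEval T p - algebraMap ℂ _ (MvPolynomial.eval μ p) =
        ∑ i, polyEval T (g i) * (T i - μ i • ContinuousLinearMap.id ℂ H) := by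
  obtain ⟨f, hf, hf'⟩ := exists_polyEval_hom hT
  suffices h : ∃ g : Fin n → MvPolynomial (Fin n) ℂ, p - MvPolynomial.C (MvPolynomial.eval μ p) =
      ∑ i, g i * (MvPolynomial.X i - MvPolynomial.C (μ i)) by
    obtain ⟨g, hg⟩ := h
    refine ⟨g, ?_⟩
    have := congrArg f hg
    rw [map_sub, map_sum, ← MvPolynomial.algebraMap_eq, AlgHom.commutes] at this
    rw [hf', this]
    refine Finset.sum_congr rfl fun i _ => ?_
    rw [map_mul, hf', map_sub, hf, AlgHom.commutes, Algebra.algebraMap_eq_smul_one]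
    rfl
  induction p using MvPolynomial.induction_on with
  | C a => exact ⟨0, by simp⟩
  | add p q hp hq =>
    obtain ⟨g, hg⟩ := hp
    obtain ⟨k, hk⟩ := hq
    refine ⟨g + k, ?_⟩
    simp only [map_add, Pi.add_apply, add_mul, Finset.sum_add_distrib, ← hg, ← hk]
    ring
  | mul_X p i hp =>
    obtain ⟨g, hg⟩ := hp
    refine ⟨fun j => g j * MvPolynomial.X i +
      if j = i then MvPolynomial.C (MvPolynomial.eval μ p) else 0, ?_⟩
    simp only [map_mul, MvPolynomial.eval_X, add_mul, Finset.sum_add_distrib, ite_mul, zero_mul,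
      Finset.sum_ite_eq', Finset.mem_univ, if_true]
    have : ∀ j, g j * MvPolynomial.X i * (MvPolynomial.X j - MvPolynomial.C (μ j)) =
      g j * (MvPolynomial.X j - MvPolynomial.C (μ j)) * MvPolynomial.X i := fun j => by ring
    simp_rw [this]
    rw [← Finset.sum_mul, ← hg]
    ring

theorem commute_sub_smul_id {A B : H →L[ℂ] H} (h : Commute A B) (c d : ℂ) :
    Commute (A - c • ContinuousLinearMap.id ℂ H) (B - d • ContinuousLinearMap.id ℂ H) := by
  have e : ∀ c : ℂ, c • ContinuousLinearMap.id ℂ H = algebraMap ℂ (H →L[ℂ] H) c := fun c => by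
    rw [Algebra.algebraMap_eq_smul_one]; rfl
  rw [e, e]
  exact (h.sub_left (Algebra.commutes _ _)).sub_right ((Algebra.commutes _ _).symm)

/-- If `p(T) - p(μ)` is invertible then `μ` is not in the Taylor spectrum. -/
theorem notMem_taylorSpectrum_of_isUnit {n : ℕ} {T : Fin n → H →L[ℂ] H}
    (hT : ∀ i j, Commute (T i) (T j)) {μ : Fin n → ℂ} (p : MvPolynomial (Fin n) ℂ)
    (hu : IsUnit (polyEval T p - algebraMap ℂ _ (MvPolynomial.eval μ p))) :
    μ ∉ taylorSpectrum T := by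
  obtain ⟨g, hg⟩ := exists_polyEval_sub T hT μ p
  obtain ⟨u, hu⟩ := hu
  have comm : ∀ j, Commute (u : H →L[ℂ] H) (T j - μ j • ContinuousLinearMap.id ℂ H) := fun j => by
    have e : μ j • ContinuousLinearMap.id ℂ H = algebraMap ℂ (H →L[ℂ] H) (μ j) := by
      rw [Algebra.algebraMap_eq_smul_one]; rfl
    rw [hu, e]
    refine Commute.sub_right ?_ (Algebra.commutes _ _).symm
    refine Commute.sub_left ?_ (Algebra.commutes _ _)
    exact (commute_polyEval hT (hT j) p).symm
  have comm' : ∀ q j, Commute (polyEval T q) (T j - μ j • ContinuousLinearMap.id ℂ H) := by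
    intro q j
    have e : μ j • ContinuousLinearMap.id ℂ H = algebraMap ℂ (H →L[ℂ] H) (μ j) := by
      rw [Algebra.algebraMap_eq_smul_one]; rfl
    rw [e]
    exact Commute.sub_right (commute_polyEval hT (hT j) q).symm (Algebra.commutes _ _).symm
  refine not_not.mpr (isNonsingular_of_sum_mul_eq_one _
    (fun i => (↑u⁻¹ : H →L[ℂ] H) * polyEval T (g i))
    (fun i j => commute_sub_smul_id (hT i j) _ _) ?_ ?_)
  · intro i j
    exact ((comm j).units_inv_left).mul_left (comm' _ _)
  · simp_rw [mul_assoc]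
    rw [← Finset.mul_sum, ← hg, ← hu, Units.inv_mul]

/-- Polynomial convexity, for a subset of `ℂⁿ`. -/
def PolyConvex {n : ℕ} (X : Set (Fin n → ℂ)) : Prop :=
  ∀ μ : Fin n → ℂ, (∀ p : MvPolynomial (Fin n) ℂ, ∀ M : ℝ,
    (∀ x ∈ X, ‖MvPolynomial.eval x p‖ ≤ M) → ‖MvPolynomial.eval μ p‖ ≤ M) → μ ∈ X

/-- The von Neumann inequality over `X`, for polynomials. -/
def PolyBounded {n : ℕ} (X : Set (Fin n → ℂ)) (T : Fin n → H →L[ℂ] H) : Prop :=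
  ∀ p : MvPolynomial (Fin n) ℂ, ∀ M : ℝ,
    (∀ x ∈ X, ‖MvPolynomial.eval x p‖ ≤ M) → ‖polyEval T p‖ ≤ M

/-- The case `q = 1`. Nothing else about spectral sets is used as a hypothesis later on; the
rational bounds are recovered from normal extensions. -/
theorem IsSpectralSet.polyBounded {n : ℕ} {X : Set (Fin n → ℂ)} (hX : X.Nonempty)
    {T : Fin n → H →L[ℂ] H} (h : IsSpectralSet X T) : PolyBounded X T := by
  intro p M hM
  have := h.2 p 1 (fun x _ => by simp)
  rw [polyEval_one, Ring.inverse_one, mul_one] at this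
  refine this.trans (csSup_le (hX.image _) ?_)
  rintro _ ⟨x, hx, rfl⟩
  simpa using hM x hx

/-- If some `p` separates `μ` from `X`, then `|p(μ)|` exceeds `‖p(T)‖`, so `p(T) - p(μ)` is
invertible; it lies in the ideal generated by the `T i - μ i`. -/
theorem PolyBounded.taylorSpectrum_subset [CompleteSpace H] {n : ℕ} {X : Set (Fin n → ℂ)}
    (hX : PolyConvex X) {T : Fin n → H →L[ℂ] H} (hT : ∀ i j, Commute (T i) (T j))
    (h : PolyBounded X T) : taylorSpectrum T ⊆ X := by
  intro μ hμ
  refine hX μ fun p M hM => ?_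
  by_contra! hlt
  refine notMem_taylorSpectrum_of_isUnit hT p ?_ hμ
  have hs : MvPolynomial.eval μ p ∉ spectrum ℂ (polyEval T p) := by
    intro hs
    rcases subsingleton_or_nontrivial H with hH | hH
    · have : Subsingleton (H →L[ℂ] H) := ⟨fun a b => by ext x; exact Subsingleton.elim _ _⟩
      simp [spectrum.of_subsingleton] at hs
    · exact absurd ((spectrum.norm_le_norm_of_mem hs).trans (h p M hM)) (not_le.mpr hlt)
  rw [spectrum.notMem_iff] at hs
  rw [← neg_sub]
  exact hs.neg

end PolyEval

/-! ### Normal tuples and Gelfand theory. -/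

open WeakDual in
theorem norm_le_of_forall_character {A : Type*} [CommCStarAlgebra A] {b : A} {M : ℝ} (hM : 0 ≤ M)
    (h : ∀ χ : characterSpace ℂ A, ‖χ b‖ ≤ M) : ‖b‖ ≤ M := by
  rw [← (gelfandTransform_isometry A).norm_map_of_map_zero (map_zero _) b]
  exact (ContinuousMap.norm_le _ hM).mpr h

open WeakDual in
theorem eq_of_forall_character {A : Type*} [CommCStarAlgebra A] {b c : A}
    (h : ∀ χ : characterSpace ℂ A, χ b = χ c) : b = c := by
  rw [← sub_eq_zero, ← norm_le_zero_iff]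
  exact norm_le_of_forall_character le_rfl fun χ => by simp [h χ]

open WeakDual in
theorem isUnit_of_forall_character {A : Type*} [CommCStarAlgebra A] {b : A}
    (h : ∀ χ : characterSpace ℂ A, χ b ≠ 0) : IsUnit b := by
  by_contra hb
  obtain ⟨χ, hχ⟩ := CharacterSpace.exists_apply_eq_zero hb
  exact h χ hχ

section
variable {K : Type u} [NormedAddCommGroup K] [InnerProductSpace ℂ K] [CompleteSpace K]

/-- Commuting normal operators lie in a commutative C⋆-algebra of operators. -/
theorem exists_commCStarAlgebra {n : ℕ} {N : Fin n → K →L[ℂ] K}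
    (hN : ∀ i j, Commute (N i) (N j)) (hn : ∀ i, IsStarNormal (N i)) :
    ∃ (A : Type u) (_ : CommCStarAlgebra A) (f : A →⋆ₐ[ℂ] (K →L[ℂ] K)) (a : Fin n → A),
      (∀ i, f (a i) = N i) ∧ (∀ b, IsUnit (f b) → IsUnit b) ∧ ∀ b, ‖f b‖ = ‖b‖ := by
  have hcs : IsMulCommutative (StarAlgebra.adjoin ℂ (Set.range N)) := by
    refine StarAlgebra.isMulCommutative_adjoin ℂ ?_ ?_
    · rintro _ ⟨i, rfl⟩ _ ⟨j, rfl⟩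
      exact hN i j
    -- Fuglede's theorem: an operator commuting with a normal operator commutes with its adjoint.
    · rintro _ ⟨i, rfl⟩ _ ⟨j, rfl⟩
      exact (hn j).commute_star_right (hN i j)
  let S := (StarAlgebra.adjoin ℂ (Set.range N)).topologicalClosure
  have hcl : IsClosed (S : Set (K →L[ℂ] K)) := StarSubalgebra.isClosed_topologicalClosure _
  have hmem : ∀ i, N i ∈ S := fun i =>
    StarSubalgebra.le_topologicalClosure _ (StarAlgebra.subset_adjoin ℂ _ ⟨i, rfl⟩)
  let I : CommCStarAlgebra S :=
    { StarSubalgebra.cstarAlgebra S with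
      mul_comm := (StarSubalgebra.commRingTopologicalClosure _
        (fun x y => hcs.is_comm.comm x y)).mul_comm }
  exact ⟨S, I, S.subtype, fun i => ⟨N i, hmem i⟩, fun i => rfl,
    fun b hb => (StarSubalgebra.coe_isUnit S).mp hb, fun b => rfl⟩

open WeakDual

theorem map_sub_smul_id {A : Type*} [CommCStarAlgebra A] (f : A →⋆ₐ[ℂ] (K →L[ℂ] K)) (a : A)
    (c : ℂ) : f a - c • ContinuousLinearMap.id ℂ K = f (a - algebraMap ℂ A c) := by
  rw [map_sub, AlgHomClass.commutes, Algebra.algebraMap_eq_smul_one]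
  rfl

/-- Otherwise the differences `d i` are jointly bounded below, which makes the positive operator `∑
d i* d i` invertible. By `hf` its preimage is invertible in `A`, yet `χ` annihilates it. -/
theorem character_mem_taylorSpectrum {A : Type*} [CommCStarAlgebra A]
    (f : A →⋆ₐ[ℂ] (K →L[ℂ] K)) (hf : ∀ b, IsUnit (f b) → IsUnit b) {n : ℕ} (a : Fin n → A)
    (χ : characterSpace ℂ A) : (fun i => χ (a i)) ∈ taylorSpectrum (fun i => f (a i)) := by
  intro hns
  obtain ⟨c, hc⟩ := hns.exists_norm_le fun i j =>
    commute_sub_smul_id (show Commute (f (a i)) (f (a j)) by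
      rw [Commute, SemiconjBy, ← map_mul, mul_comm, map_mul]) _ _
  simp_rw [map_sub_smul_id] at hc
  set d : Fin n → A := fun i => a i - algebraMap ℂ A (χ (a i)) with hd
  have hχd : ∀ i, χ (d i) = 0 := fun i => by
    rw [hd]
    simp only [map_sub, AlgHomClass.commutes]
    simp
  set b : A := ∑ i, star (d i) * d i with hb
  have hχ : χ b = 0 := by
    rw [hb, map_sum]
    exact Finset.sum_eq_zero fun i _ => by rw [map_mul, hχd, mul_zero]
  have hbu : ¬ IsUnit b := fun hu => by
    have := hu.map χ
    rw [hχ] at this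
    exact not_isUnit_zero this
  refine hbu (hf b ?_)
  have inner_eq : ∀ x, inner ℂ (f b x) x = ((∑ i, ‖f (d i) x‖ ^ 2 : ℝ) : ℂ) := fun x => by
    have : f b x = ∑ i, (ContinuousLinearMap.adjoint (f (d i))) (f (d i) x) := by
      rw [hb, map_sum, sum_apply]
      refine Finset.sum_congr rfl fun i _ => ?_
      rw [map_mul, map_star]
      rfl
    rw [this, sum_inner]
    push_cast
    refine Finset.sum_congr rfl fun i _ => ?_
    rw [ContinuousLinearMap.adjoint_inner_left, inner_self_eq_norm_sq_to_K]
    rfl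
  -- The constant uses `c + 1` instead of `c` because `c` may be zero.
  refine ContinuousLinearMap.isUnit_of_forall_le_norm_inner_map (f b) (c := ((c + 1) ^ 2)⁻¹)
    (by positivity) fun x => ?_
  rw [inner_eq, Complex.norm_real, Real.norm_of_nonneg (by positivity)]
  have h1 : ‖fun i => f (d i) x‖ ^ 2 ≤ ∑ i, ‖f (d i) x‖ ^ 2 := by
    have : ‖fun i => f (d i) x‖ ≤ Real.sqrt (∑ i, ‖f (d i) x‖ ^ 2) :=
      (pi_norm_le_iff_of_nonneg (Real.sqrt_nonneg _)).mpr fun i => Real.le_sqrt_of_sq_le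
        (Finset.single_le_sum (f := fun i => ‖f (d i) x‖ ^ 2)
          (fun _ _ => by positivity) (Finset.mem_univ i))
    calc _ ≤ _ := pow_le_pow_left₀ (norm_nonneg _) this 2
      _ = _ := Real.sq_sqrt (by positivity)
  refine le_trans ?_ h1
  push_cast
  rw [← inv_pow, mul_comm, ← mul_pow]
  refine pow_le_pow_left₀ (by positivity) ?_ 2
  rw [inv_mul_le_iff₀ (by positivity)]
  refine (hc x).trans ?_
  gcongr
  simp

/-- For `μ` outside `X` no character kills all the `d i`, so `∑ d i* d i` is invertible and supplies
the coefficients of a Koszul homotopy. -/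
theorem taylorSpectrum_subset_of_character {A : Type*} [CommCStarAlgebra A]
    (f : A →⋆ₐ[ℂ] (K →L[ℂ] K)) {n : ℕ} (a : Fin n → A) {X : Set (Fin n → ℂ)}
    (hX : ∀ χ : characterSpace ℂ A, (fun i => χ (a i)) ∈ X) :
    taylorSpectrum (fun i => f (a i)) ⊆ X := by
  intro μ hμ
  by_contra hμX
  refine hμ ?_
  simp_rw [map_sub_smul_id]
  set d : Fin n → A := fun i => a i - algebraMap ℂ A (μ i) with hd
  have hχd : ∀ (χ : characterSpace ℂ A) i, χ (d i) = χ (a i) - μ i := fun χ i => by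
    rw [hd]
    simp only [map_sub, AlgHomClass.commutes]
    simp
  have hb : IsUnit (∑ i, star (d i) * d i) := by
    refine isUnit_of_forall_character fun χ h0 => hμX ?_
    rw [map_sum] at h0
    have e : ∀ i, χ (star (d i) * d i) = ((‖χ (d i)‖ ^ 2 : ℝ) : ℂ) := fun i => by
      rw [map_mul, map_star, mul_comm]
      push_cast
      exact Complex.mul_conj' _
    simp_rw [e] at h0
    rw [← Complex.ofReal_sum, Complex.ofReal_eq_zero,
      Finset.sum_eq_zero_iff_of_nonneg fun _ _ => by positivity] at h0
    convert hX χ using 1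
    funext i
    have := h0 i (Finset.mem_univ i)
    rw [hχd, sq_eq_zero_iff, norm_eq_zero, sub_eq_zero] at this
    exact this.symm
  obtain ⟨u, hu⟩ := hb
  have comm : ∀ x y : A, Commute (f x) (f y) := fun x y => by
    rw [Commute, SemiconjBy, ← map_mul, mul_comm, map_mul]
  refine isNonsingular_of_sum_mul_eq_one _ (fun i => f (↑u⁻¹ * star (d i)))
    (fun i j => comm _ _) (fun i j => comm _ _) ?_
  simp_rw [← map_mul, mul_assoc]
  rw [← map_sum, ← Finset.mul_sum, ← hu, Units.inv_mul, map_one]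

theorem map_aeval {n : ℕ} {A : Type*} [CommCStarAlgebra A] (χ : characterSpace ℂ A) (a : Fin n → A)
    (p : MvPolynomial (Fin n) ℂ) :
    χ (MvPolynomial.aeval a p) = MvPolynomial.eval (fun i => χ (a i)) p := by
  rw [← MvPolynomial.coe_aeval_eq_eval]
  exact (MvPolynomial.comp_aeval_apply (φ := (CharacterSpace.toAlgHom χ)) a p)

end

section
variable {H : Type u} [NormedAddCommGroup H] [InnerProductSpace ℂ H] [CompleteSpace H]
variable {K : Type u} [NormedAddCommGroup K] [InnerProductSpace ℂ K] [CompleteSpace K]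

open WeakDual

/-- A polynomially convex compact set that contains the joint spectrum of a commuting normal tuple
is a spectral set for all its restrictions. -/
theorem isSpectralSet_of_intertwine {n : ℕ} {X : Set (Fin n → ℂ)} (hX : PolyConvex X)
    (hXc : IsCompact X) (hXne : X.Nonempty) {T : Fin n → H →L[ℂ] H} (hT : ∀ i j, Commute (T i) (T j))
    (V : H →ₗᵢ[ℂ] K) {A : Type*} [CommCStarAlgebra A] (f : A →⋆ₐ[ℂ] (K →L[ℂ] K))
    (hf : ∀ b, ‖f b‖ = ‖b‖) (a : Fin n → A) (hV : ∀ i x, f (a i) (V x) = V (T i x))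
    (ha : ∀ χ : characterSpace ℂ A, (fun i => χ (a i)) ∈ X) : IsSpectralSet X T := by
  have comm : ∀ i j, Commute (f (a i)) (f (a j)) := fun x y => by
    rw [Commute, SemiconjBy, ← map_mul, mul_comm, map_mul]
  -- The bound is stated without inverses so that it restricts to `H`, which the inverse of `q` of
  -- the extension need not leave invariant.
  have key : ∀ p q : MvPolynomial (Fin n) ℂ, (∀ x ∈ X, MvPolynomial.eval x q ≠ 0) → ∀ M : ℝ,
      0 ≤ M → (∀ x ∈ X, ‖MvPolynomial.eval x p / MvPolynomial.eval x q‖ ≤ M) → ∀ y,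
      ‖polyEval T p y‖ ≤ M * ‖polyEval T q y‖ := by
    intro p q hq M hM0 hM y
    have hu : IsUnit (MvPolynomial.aeval a q) := isUnit_of_forall_character fun χ => by
      rw [map_aeval]
      exact hq _ (ha χ)
    obtain ⟨u, hu⟩ := hu
    have h1 : ‖MvPolynomial.aeval a p * ↑u⁻¹‖ ≤ M := norm_le_of_forall_character hM0 fun χ => by
      have h2 : χ (↑u⁻¹) = (MvPolynomial.eval (fun i => χ (a i)) q)⁻¹ := by
        rw [← map_aeval, ← hu]
        refine eq_inv_of_mul_eq_one_left ?_
        rw [← map_mul, Units.inv_mul, map_one]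
      rw [map_mul, h2, map_aeval, ← div_eq_mul_inv]
      exact hM _ (ha χ)
    have e : ∀ r, V (polyEval T r y) = f (MvPolynomial.aeval a r) (V y) := fun r => by
      have := polyEval_intertwine hT comm V.toLinearMap hV r y
      have h3 := polyEval_eq_aeval (f : A →ₐ[ℂ] (K →L[ℂ] K)) a r
      exact this.symm.trans (congrArg (fun B : K →L[ℂ] K => B (V y)) h3)
    rw [← V.norm_map, ← V.norm_map (polyEval T q y), e, e]
    have h4 : MvPolynomial.aeval a p =
        (MvPolynomial.aeval a p * ↑u⁻¹) * MvPolynomial.aeval a q := by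
      rw [mul_assoc, ← hu, Units.inv_mul, mul_one]
    rw [h4, map_mul, mul_apply_eq_comp]
    refine (ContinuousLinearMap.le_opNorm _ _).trans ?_
    rw [hf]
    gcongr
  refine ⟨PolyBounded.taylorSpectrum_subset hX hT fun p M hM => ?_, fun p q hq => ?_⟩
  · obtain ⟨x, hx⟩ := hXne
    have hM0 : 0 ≤ M := (norm_nonneg _).trans (hM x hx)
    refine ContinuousLinearMap.opNorm_le_bound _ hM0 fun y => ?_
    have := key p 1 (by simp) M hM0 (by simpa using hM) y
    simpa [polyEval_one] using this
  · set M := sSup ((fun x => ‖MvPolynomial.eval x p / MvPolynomial.eval x q‖) '' X) with hM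
    have hM0 : 0 ≤ M := Real.sSup_nonneg (by rintro _ ⟨x, -, rfl⟩; positivity)
    have hbd : ∀ x ∈ X, ‖MvPolynomial.eval x p / MvPolynomial.eval x q‖ ≤ M := fun x hx => by
      refine le_csSup (hXc.image_of_continuousOn ?_).bddAbove ⟨x, hx, rfl⟩
      exact ((MvPolynomial.continuous_eval p).continuousOn.div
        (MvPolynomial.continuous_eval q).continuousOn hq).norm
    -- Invertibility of `q(T)` need not be proved: for a non-unit `Ring.inverse` is zero and the
    -- bound is trivial.
    by_cases hu : IsUnit (polyEval T q)
    · refine ContinuousLinearMap.opNorm_le_bound _ hM0 fun y => ?_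
      have h1 := key p q hq M hM0 hbd (Ring.inverse (polyEval T q) y)
      have h2 := congrArg (fun B : H →L[ℂ] H => B y) (Ring.mul_inverse_cancel _ hu)
      simp only [mul_apply_eq_comp, one_apply_eq_self] at h2
      rwa [h2] at h1
    · rw [Ring.inverse_non_unit _ hu, mul_zero, norm_zero]
      exact hM0

end

/-! ### Geometry of `Γ_n`: zeros of polynomials, polynomial convexity, Cohn's theorem. -/

open Polynomial in
/-- The monic polynomial `Xⁿ - s₁ Xⁿ⁻¹ + s₂ Xⁿ⁻² - ⋯`. -/
def symPoly {n : ℕ} (s : Fin n → ℂ) : ℂ[X] :=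
  X ^ n + ∑ i : Fin n, (-1) ^ ((i : ℕ) + 1) * (C (s i) * X ^ (n - ((i : ℕ) + 1)))

theorem symMap_eq_esymm {n : ℕ} (z : Fin n → ℂ) (i : Fin n) :
    symMap n z i = ((Finset.univ : Finset (Fin n)).val.map z).esymm ((i : ℕ) + 1) :=
  (Finset.esymm_map_val z _ _).symm

theorem symPoly_symMap {n : ℕ} (z : Fin n → ℂ) :
    symPoly (symMap n z) = ∏ k, (Polynomial.X - Polynomial.C (z k)) := by
  have h := Multiset.prod_X_sub_X_eq_sum_esymm ((Finset.univ : Finset (Fin n)).val.map z)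
  rw [Multiset.map_map] at h
  refine Eq.trans ?_ h.symm
  simp only [Multiset.card_map, Finset.card_val, Finset.card_univ, Fintype.card_fin]
  rw [Finset.sum_range_succ', symPoly, Finset.sum_range, add_comm]
  simp [symMap_eq_esymm, Multiset.esymm]

theorem eval_symPoly {n : ℕ} (s : Fin n → ℂ) (u : ℂ) : (symPoly s).eval u =
    u ^ n + ∑ i : Fin n, (-1) ^ ((i : ℕ) + 1) * (s i * u ^ (n - ((i : ℕ) + 1))) := by
  simp [symPoly, Polynomial.eval_finsetSum]

theorem coeff_symPoly {n : ℕ} (s : Fin n → ℂ) (i : Fin n) :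
    (symPoly s).coeff (n - ((i : ℕ) + 1)) = (-1) ^ ((i : ℕ) + 1) * s i := by
  have e : ∀ (j : ℕ) (p : Polynomial ℂ), (-1) ^ j * p = Polynomial.C ((-1) ^ j) * p := fun j p => by
    simp
  rw [symPoly, Polynomial.coeff_add, Polynomial.finsetSum_coeff, Finset.sum_eq_single i]
  · rw [e, Polynomial.coeff_C_mul, Polynomial.coeff_C_mul, Polynomial.coeff_X_pow,
      Polynomial.coeff_X_pow, if_neg (by omega)]
    simp
  · intro j _ hj
    rw [e, Polynomial.coeff_C_mul, Polynomial.coeff_C_mul, Polynomial.coeff_X_pow, if_neg]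
    · simp
    · intro h
      exact hj (Fin.ext (by omega))
  · simp

theorem symPoly_injective {n : ℕ} : Function.Injective (symPoly (n := n)) := by
  intro s t h
  funext i
  have := congrArg (fun p => Polynomial.coeff p (n - ((i : ℕ) + 1))) h
  simp only [coeff_symPoly] at this
  exact mul_left_cancel₀ (pow_ne_zero _ (by norm_num)) this

theorem natDegree_symPoly_le {n : ℕ} (s : Fin n → ℂ) : (symPoly s).natDegree ≤ n := by
  have e : ∀ (j : ℕ) (p : Polynomial ℂ), (-1) ^ j * p = Polynomial.C ((-1) ^ j) * p := fun j p => by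
    simp
  refine Polynomial.natDegree_add_le_of_degree_le (Polynomial.natDegree_X_pow_le _) ?_
  refine Polynomial.natDegree_sum_le_of_forall_le _ _ fun i _ => ?_
  rw [e]
  refine (Polynomial.natDegree_C_mul_le _ _).trans ((Polynomial.natDegree_C_mul_le _ _).trans ?_)
  exact (Polynomial.natDegree_X_pow_le _).trans (Nat.sub_le _ _)

theorem coeff_symPoly_self {n : ℕ} (s : Fin n → ℂ) : (symPoly s).coeff n = 1 := by
  have e : ∀ (j : ℕ) (p : Polynomial ℂ), (-1) ^ j * p = Polynomial.C ((-1) ^ j) * p := fun j p => by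
    simp
  rw [symPoly, Polynomial.coeff_add, Polynomial.finsetSum_coeff, Finset.sum_eq_zero]
  · simp
  · intro i _
    rw [e, Polynomial.coeff_C_mul, Polynomial.coeff_C_mul, Polynomial.coeff_X_pow,
      if_neg (by omega)]
    simp

/-- The symmetrization map is onto. -/
theorem exists_symMap_eq {n : ℕ} (s : Fin n → ℂ) : ∃ z, symMap n z = s := by
  have hm : (symPoly s).Monic :=
    Polynomial.monic_of_natDegree_le_of_coeff_eq_one n (natDegree_symPoly_le s)
      (coeff_symPoly_self s)
  have hd : (symPoly s).natDegree = n :=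
    Polynomial.natDegree_eq_of_le_of_coeff_ne_zero (natDegree_symPoly_le s)
      (by rw [coeff_symPoly_self]; exact one_ne_zero)
  have hs := IsAlgClosed.splits (symPoly s)
  have hcard : (symPoly s).roots.toList.length = n := by
    rw [Multiset.length_toList, ← hs.natDegree_eq_card_roots, hd]
  refine ⟨fun i => (symPoly s).roots.toList.get (i.cast hcard.symm), symPoly_injective ?_⟩
  rw [symPoly_symMap]
  conv_rhs => rw [hs.eq_prod_roots_of_monic hm, ← Multiset.coe_toList (symPoly s).roots]
  rw [Multiset.map_coe, Multiset.prod_coe, ← List.prod_ofFn]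
  congr 1
  refine List.ext_get (by simp [hcard]) fun i h1 h2 => ?_
  simp

theorem eval_symPoly_symMap {n : ℕ} (z : Fin n → ℂ) (u : ℂ) :
    (symPoly (symMap n z)).eval u = ∏ k, (u - z k) := by
  simp [symPoly_symMap, Polynomial.eval_prod]

theorem continuous_symMap (n : ℕ) : Continuous (symMap n) := by
  unfold symMap
  fun_prop

theorem isCompact_Gam (n : ℕ) : IsCompact (Gam n) := by
  have : {z : Fin n → ℂ | ∀ k, ‖z k‖ ≤ 1} = Metric.closedBall 0 1 := by
    ext z
    simp [pi_norm_le_iff_of_nonneg]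
  rw [Gam, this]
  exact (isCompact_closedBall _ _).image (continuous_symMap n)

theorem Gam_nonempty (n : ℕ) : (Gam n).Nonempty := ⟨_, 0, by simp, rfl⟩

theorem bGam_subset_Gam (n : ℕ) : bGam n ⊆ Gam n := by
  rintro _ ⟨z, hz, rfl⟩
  exact ⟨z, fun k => (hz k).le, rfl⟩

open MvPolynomial in
/-- The elementary symmetric polynomials of the `k`-th powers are polynomials in the elementary
symmetric polynomials. -/
theorem exists_eval_symMap_eq_pow {n : ℕ} (k : ℕ) (j : Fin n) :
    ∃ q : MvPolynomial (Fin n) ℂ,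
      ∀ z : Fin n → ℂ, MvPolynomial.eval (symMap n z) q = symMap n (fun i => z i ^ k) j := by
  set p : MvPolynomial (Fin n) ℂ := aeval (fun i => X i ^ k) (esymm (Fin n) ℂ ((j : ℕ) + 1))
    with hp
  have hsymm : p.IsSymmetric := by
    intro e
    have h1 : rename e p = aeval (fun i => X (e i) ^ k) (esymm (Fin n) ℂ ((j : ℕ) + 1)) := by
      rw [hp, comp_aeval_apply]
      simp
    rw [h1]
    conv_rhs => rw [hp, ← rename_esymm (Fin n) ℂ _ e, aeval_rename]
    rfl
  -- The fundamental theorem of symmetric polynomials.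
  obtain ⟨q, hq⟩ := esymmAlgHom_fin_surjective ℂ (le_refl n) ⟨p, hsymm⟩
  refine ⟨q, fun z => ?_⟩
  have h2 : aeval (fun i : Fin n ↦ esymm (Fin n) ℂ ((i : ℕ) + 1)) q = p := by
    rw [← esymmAlgHom_apply, hq]
  have h3 := congrArg (aeval z) h2
  rw [comp_aeval_apply, hp, comp_aeval_apply] at h3
  have e1 : (fun i : Fin n => aeval z (esymm (Fin n) ℂ ((i : ℕ) + 1))) = symMap n z := by
    funext i
    rw [symMap_eq_esymm, aeval_esymm_eq_multiset_esymm]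
  rw [e1, aeval_esymm_eq_multiset_esymm] at h3
  rw [symMap_eq_esymm, ← coe_aeval_eq_eval]
  refine h3.trans ?_
  simp

theorem norm_symMap_le {n : ℕ} {z : Fin n → ℂ} (hz : ∀ k, ‖z k‖ ≤ 1) (i : Fin n) :
    ‖symMap n z i‖ ≤ 2 ^ n := by
  rw [symMap]
  refine (norm_sum_le _ _).trans ?_
  have : ∀ A ∈ Finset.powersetCard ((i : ℕ) + 1) (Finset.univ : Finset (Fin n)),
      ‖∏ k ∈ A, z k‖ ≤ 1 := fun A _ => by
    rw [norm_prod]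
    exact Finset.prod_le_one (fun _ _ => norm_nonneg _) fun k _ => hz k
  refine (Finset.sum_le_card_nsmul _ _ _ this).trans ?_
  rw [Finset.card_powersetCard, Finset.card_univ, Fintype.card_fin, nsmul_eq_mul, mul_one]
  exact_mod_cast Nat.choose_le_two_pow n _

/-- The monic equation gives `|z|ⁿ ≤ n M |z|ⁿ⁻¹` once `|z| ≥ 1`. -/
theorem norm_root_le {n : ℕ} {z : Fin n → ℂ} {M : ℝ} (hM : ∀ i, ‖symMap n z i‖ ≤ M) (k : Fin n)
    (hk : 1 ≤ ‖z k‖) : ‖z k‖ ≤ n * M := by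
  have h0 : (symPoly (symMap n z)).eval (z k) = 0 := by
    rw [eval_symPoly_symMap]
    exact Finset.prod_eq_zero (Finset.mem_univ k) (sub_self _)
  rw [eval_symPoly] at h0
  have h1 := congrArg norm (eq_neg_of_add_eq_zero_left h0)
  rw [norm_neg, norm_pow] at h1
  have hn : n = (n - 1) + 1 := by have := k.pos; omega
  have h2 : ‖z k‖ ^ n ≤ ∑ i : Fin n, M * ‖z k‖ ^ (n - 1) := by
    rw [h1]
    refine (norm_sum_le _ _).trans (Finset.sum_le_sum fun i _ => ?_)
    rw [norm_mul, norm_mul, norm_pow, norm_neg, norm_one, one_pow, one_mul, norm_pow]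
    have hM0 : 0 ≤ M := (norm_nonneg _).trans (hM i)
    exact mul_le_mul (hM i) (pow_le_pow_right₀ hk (by omega)) (by positivity) hM0
  rw [Finset.sum_const, Finset.card_univ, Fintype.card_fin, nsmul_eq_mul, ← mul_assoc] at h2
  have h3 : ‖z k‖ ^ n = ‖z k‖ * ‖z k‖ ^ (n - 1) := by
    conv_lhs => rw [hn]
    rw [pow_succ, mul_comm]
  rw [h3] at h2
  exact le_of_mul_le_mul_right h2 (by positivity)

theorem polyConvex_Gam (n : ℕ) : PolyConvex (Gam n) := by
  intro μ hμ
  obtain ⟨z, rfl⟩ := exists_symMap_eq μ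
  refine ⟨z, fun k => ?_, rfl⟩
  by_contra! hk
  -- The elementary symmetric functions of the `r`-th powers are polynomials on `Γ_n` bounded by
  -- `2ⁿ` uniformly in `r`. Hence all powers of `z k` are bounded, which is impossible outside the
  -- disc.
  have key : ∀ r : ℕ, ‖z k‖ ^ r ≤ n * 2 ^ n := by
    intro r
    have := norm_root_le (z := fun i => z i ^ r) (M := 2 ^ n) ?_ k ?_
    · simpa using this
    · intro j
      obtain ⟨q, hq⟩ := exists_eval_symMap_eq_pow r j
      rw [← hq]
      refine hμ q _ ?_
      rintro _ ⟨w, hw, rfl⟩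
      rw [hq]
      exact norm_symMap_le (fun i => by rw [norm_pow]; exact pow_le_one₀ (norm_nonneg _) (hw i)) j
    · rw [norm_pow]
      exact one_le_pow₀ hk.le
  obtain ⟨r, hr⟩ := pow_unbounded_of_one_lt ((n : ℝ) * 2 ^ n) hk
  exact absurd (key r) (not_le.mpr hr)

/-- The scaling which corresponds to taking derivatives of polynomials. -/
def scaleVec {m : ℕ} (s : Fin (m + 1) → ℂ) : Fin m → ℂ :=
  fun j => (((m : ℂ) - (j : ℕ)) / ((m : ℂ) + 1)) * s j.castSucc

theorem derivative_symPoly {m : ℕ} (s : Fin (m + 1) → ℂ) :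
    Polynomial.derivative (symPoly s) =
      Polynomial.C ((m : ℂ) + 1) * symPoly (scaleVec s) := by
  have hm : (m : ℂ) + 1 ≠ 0 := by exact_mod_cast Nat.succ_ne_zero m
  have e : ∀ (j : ℕ) (p : Polynomial ℂ), (-1) ^ j * p = Polynomial.C ((-1) ^ j) * p := fun j p => by
    simp
  simp only [symPoly, e]
  rw [Polynomial.derivative_add, Polynomial.derivative_X_pow, mul_add, Polynomial.derivative_sum,
    Fin.sum_univ_castSucc, Finset.mul_sum]
  simp only [Polynomial.derivative_C_mul, Polynomial.derivative_X_pow]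
  congr 1
  · simp
  · simp only [Fin.val_last, Nat.sub_self, Nat.cast_zero, Polynomial.C_0, zero_mul, mul_zero,
      add_zero]
    refine Finset.sum_congr rfl fun j _ => ?_
    have h1 : m + 1 - ((j.castSucc : ℕ) + 1) = m - j := by simp
    have h2 : m - (j : ℕ) - 1 = m - ((j : ℕ) + 1) := by omega
    have h3 : ((m - (j : ℕ) : ℕ) : ℂ) = (m : ℂ) - (j : ℕ) := by
      rw [Nat.cast_sub j.2.le]
    rw [h1, h2, h3]
    simp only [← mul_assoc, ← Polynomial.C_mul]
    congr 2
    simp only [scaleVec, Fin.val_castSucc]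
    field_simp

/-- By the Gauss–Lucas theorem the scaling maps `Γ_{m+1}` to `Γ_m`. -/
theorem scaleVec_mem_Gam {m : ℕ} {s : Fin (m + 1) → ℂ} (hs : s ∈ Gam (m + 1)) :
    scaleVec s ∈ Gam m := by
  obtain ⟨z, hz, rfl⟩ := hs
  obtain ⟨w, hw⟩ := exists_symMap_eq (scaleVec (symMap (m + 1) z))
  refine ⟨w, fun k => ?_, hw⟩
  have hm : (m : ℂ) + 1 ≠ 0 := by exact_mod_cast Nat.succ_ne_zero m
  have hdeg : 0 < (symPoly (symMap (m + 1) z)).degree := by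
    rw [symPoly_symMap, Polynomial.degree_prod]
    simp
    exact_mod_cast Nat.succ_pos m
  have h1 : w k ∈ (Polynomial.derivative (symPoly (symMap (m + 1) z))).rootSet ℂ := by
    rw [Polynomial.mem_rootSet, Polynomial.coe_aeval_eq_eval]
    constructor
    · rw [derivative_symPoly, ← hw, symPoly_symMap]
      refine mul_ne_zero (Polynomial.C_ne_zero.mpr hm) ?_
      exact Finset.prod_ne_zero_iff.mpr fun i _ => Polynomial.X_sub_C_ne_zero _
    · rw [derivative_symPoly, ← hw, Polynomial.eval_mul, eval_symPoly_symMap,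
        Finset.prod_eq_zero (Finset.mem_univ k) (sub_self _), mul_zero]
  have h2 := Polynomial.rootSet_derivative_subset_convexHull_rootSet hdeg h1
  have h3 : (symPoly (symMap (m + 1) z)).rootSet ℂ ⊆ Metric.closedBall 0 1 := by
    intro u hu
    rw [Polynomial.mem_rootSet, Polynomial.coe_aeval_eq_eval] at hu
    have hu2 := hu.2
    rw [eval_symPoly_symMap, Finset.prod_eq_zero_iff] at hu2
    obtain ⟨i, -, hi⟩ := hu2
    rw [sub_eq_zero] at hi
    simpa [hi] using hz i
  have h4 := convexHull_min h3 (convex_closedBall 0 1) h2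
  simpa using h4

theorem symMap_last {m : ℕ} (z : Fin (m + 1) → ℂ) : symMap (m + 1) z (Fin.last m) = ∏ k, z k := by
  have : Finset.powersetCard (m + 1) (Finset.univ : Finset (Fin (m + 1))) = {Finset.univ} := by
    have := Finset.powersetCard_self (Finset.univ : Finset (Fin (m + 1)))
    simpa using this
  rw [symMap, Fin.val_last, this, Finset.sum_singleton]

/-- On the torus conjugation is inversion, so multiplying a conjugated monomial by the full product
gives the monomial of the complementary index set. -/
theorem symMap_castSucc_eq {m : ℕ} {z : Fin (m + 1) → ℂ} (hz : ∀ k, ‖z k‖ = 1) (j : Fin m) :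
    symMap (m + 1) z j.castSucc =
      star (symMap (m + 1) z j.rev.castSucc) * symMap (m + 1) z (Fin.last m) := by
  rw [symMap_last, symMap, symMap, star_sum, Finset.sum_mul]
  refine Finset.sum_bij' (fun A _ => Aᶜ) (fun A _ => Aᶜ) ?_ ?_ ?_ ?_ ?_
  · intro A hA
    rw [Finset.mem_powersetCard] at hA ⊢
    refine ⟨Finset.subset_univ _, ?_⟩
    rw [Finset.card_compl, hA.2, Fintype.card_fin]
    simp [Fin.val_rev]
    omega
  · intro A hA
    rw [Finset.mem_powersetCard] at hA ⊢
    refine ⟨Finset.subset_univ _, ?_⟩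
    rw [Finset.card_compl, hA.2, Fintype.card_fin]
    simp [Fin.val_rev]
    omega
  · simp
  · simp
  · intro A _
    have h1 : ∀ k, star (z k) * z k = 1 := fun k => by
      have := Complex.conj_mul' (z k)
      rw [hz k] at this
      simpa using this
    rw [← Finset.prod_mul_prod_compl A z, mul_left_comm, star_prod, ← Finset.prod_mul_distrib,
      Finset.prod_congr rfl fun k _ => h1 k]
    simp

theorem norm_symMap_last {m : ℕ} {z : Fin (m + 1) → ℂ} (hz : ∀ k, ‖z k‖ = 1) :
    ‖symMap (m + 1) z (Fin.last m)‖ = 1 := by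
  rw [symMap_last, norm_prod]
  simp [hz]

/-- The squares differ by `(1 - |w|²)(|ζ|² - 1)`. -/
theorem norm_one_sub_mul_conj_le {w ζ : ℂ} (hw : ‖w‖ ≤ 1) (hζ : 1 ≤ ‖ζ‖) :
    ‖1 - w * star ζ‖ ≤ ‖ζ - w‖ := by
  refine le_of_sq_le_sq ?_ (norm_nonneg _)
  rw [← Complex.normSq_eq_norm_sq, ← Complex.normSq_eq_norm_sq]
  have h1 : Complex.normSq w ≤ 1 := by
    rw [Complex.normSq_eq_norm_sq]; exact pow_le_one₀ (norm_nonneg _) hw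
  have h2 : 1 ≤ Complex.normSq ζ := by
    rw [Complex.normSq_eq_norm_sq]; exact one_le_pow₀ hζ
  rw [Complex.normSq_apply] at h1 h2 ⊢
  rw [Complex.normSq_apply]
  simp
  nlinarith [mul_nonneg (sub_nonneg.mpr h1) (sub_nonneg.mpr h2)]

/-- The reversed derivative of a self-inversive polynomial. -/
theorem self_inversive_identity {m : ℕ} {s : Fin (m + 1) → ℂ}
    (hs : ∀ j : Fin m, s j.castSucc = star (s j.rev.castSucc) * s (Fin.last m)) {ζ : ℂ}
    (hζ : ζ ≠ 0) :
    (-1) ^ (m + 1) * s (Fin.last m) *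
        (ζ ^ m * star ((symPoly (scaleVec s)).eval (star ζ)⁻¹)) =
      (symPoly s).eval ζ - ζ * (symPoly (scaleVec s)).eval ζ := by
  have hm : (m : ℂ) + 1 ≠ 0 := by exact_mod_cast Nat.succ_ne_zero m
  rw [eval_symPoly, eval_symPoly, eval_symPoly, Fin.sum_univ_castSucc, star_add, star_sum, mul_add,
    mul_add, mul_add ζ, Finset.mul_sum, Finset.mul_sum, Finset.mul_sum]
  have e1 : (-1) ^ (m + 1) * s (Fin.last m) * (ζ ^ m * star ((star ζ)⁻¹ ^ m)) =
      (-1) ^ (m + 1) * s (Fin.last m) := by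
    rw [star_pow, star_inv₀, star_star, inv_pow, mul_inv_cancel₀ (pow_ne_zero _ hζ), mul_one]
  rw [e1, ← Equiv.sum_comp Fin.revPerm]
  -- The relations `hs` turn the reflected coefficient into `(i + 1) / (m + 1)` times `s i`, and
  -- this weight is one minus the weight in `scaleVec s i`.
  have e2 : ∀ i : Fin m,
      (-1) ^ (m + 1) * s (Fin.last m) * (ζ ^ m * star ((-1) ^ (((Fin.revPerm i : Fin m) : ℕ) + 1) *
        (scaleVec s (Fin.revPerm i) *
          (star ζ)⁻¹ ^ (m - (((Fin.revPerm i : Fin m) : ℕ) + 1))))) =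
      (-1) ^ ((i.castSucc : ℕ) + 1) * (s i.castSucc * ζ ^ (m + 1 - ((i.castSucc : ℕ) + 1))) -
      ζ * ((-1) ^ ((i : ℕ) + 1) * (scaleVec s i * ζ ^ (m - ((i : ℕ) + 1)))) := by
    intro i
    obtain ⟨k, hk⟩ : ∃ k, m = i + 1 + k := ⟨m - (i + 1), by omega⟩
    have h1 : ((Fin.revPerm i : Fin m) : ℕ) = k := by
      rw [Fin.revPerm_apply, Fin.val_rev]; omega
    have h2 : m - (k + 1) = (i : ℕ) := by omega
    have h3 : m + 1 - ((i.castSucc : ℕ) + 1) = k + 1 := by simp; omega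
    have h4 : m - ((i : ℕ) + 1) = k := by omega
    have h5 : ζ ^ m * star ((star ζ)⁻¹ ^ (i : ℕ)) = ζ ^ (k + 1) := by
      rw [star_pow, star_inv₀, star_star, inv_pow, ← div_eq_mul_inv,
        div_eq_iff (pow_ne_zero _ hζ), ← pow_add]
      congr 1
      omega
    have h6 : star (scaleVec s (Fin.revPerm i)) * s (Fin.last m) =
        (((i : ℕ) : ℂ) + 1) / ((m : ℂ) + 1) * s i.castSucc := by
      rw [hs i, scaleVec, h1, Fin.revPerm_apply, star_mul', mul_assoc]
      congr 1
      rw [star_div₀]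
      simp [hk]
    have h7 : (((i : ℕ) : ℂ) + 1) / ((m : ℂ) + 1) * s i.castSucc = s i.castSucc - scaleVec s i := by
      rw [scaleVec]
      field_simp
      ring
    have h8 : ((-1 : ℂ)) ^ (m + 1) * (-1) ^ (k + 1) = (-1) ^ ((i : ℕ) + 1) := by
      rw [← pow_add, show m + 1 + (k + 1) = (i + 1) + 2 * (k + 1) by omega, pow_add, pow_mul]
      simp
    rw [h1, h2, h3, h4, star_mul', star_mul', Fin.val_castSucc]
    have h9 : star ((-1 : ℂ) ^ (k + 1)) = (-1) ^ (k + 1) := by simp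
    rw [h9]
    calc _ = ((-1 : ℂ) ^ (m + 1) * (-1) ^ (k + 1)) *
          (star (scaleVec s (Fin.revPerm i)) * s (Fin.last m)) *
          (ζ ^ m * star ((star ζ)⁻¹ ^ (i : ℕ))) := by ring
      _ = _ := by rw [h5, h6, h7, h8]; ring
  rw [Finset.sum_congr rfl fun i _ => e2 i, Finset.sum_sub_distrib]
  simp only [Fin.val_last, Nat.sub_self, pow_zero, mul_one]
  ring

/-- A self-inversive polynomial whose derivative has all its zeros in the closed disc has all its
zeros on the circle (A. Cohn). -/
theorem mem_bGam_of_scaleVec {m : ℕ} {s : Fin (m + 1) → ℂ} (hp : ‖s (Fin.last m)‖ = 1)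
    (hs : ∀ j : Fin m, s j.castSucc = star (s j.rev.castSucc) * s (Fin.last m))
    (hd : scaleVec s ∈ Gam m) : s ∈ bGam (m + 1) := by
  obtain ⟨z, rfl⟩ := exists_symMap_eq s
  obtain ⟨w, hw, hws⟩ := hd
  -- Let `g` be the monic polynomial with zeros `w i`. At a zero `ζ` with `|ζ| > 1` the identity
  -- reads `|ζ|^m |g(1/conj ζ)| = |ζ| |g(ζ)|`. Comparing factors, the left side is at most `|g(ζ)|`,
  -- which is nonzero: a contradiction.
  have hle : ∀ k, ‖z k‖ ≤ 1 := by
    intro k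
    by_contra! hk
    have hζ : z k ≠ 0 := norm_pos_iff.mp (one_pos.trans hk)
    have h := congrArg norm (self_inversive_identity hs hζ)
    rw [eval_symPoly_symMap, Finset.prod_eq_zero (Finset.mem_univ k) (sub_self _), zero_sub,
      norm_neg, norm_mul, norm_mul, norm_mul, norm_mul, hp, norm_pow, norm_neg, norm_one, one_pow,
      one_mul, one_mul, norm_star, ← hws, eval_symPoly_symMap, eval_symPoly_symMap, norm_prod,
      norm_prod, norm_pow] at h
    have h1 : ‖z k‖ ^ m * ∏ i, ‖(star (z k))⁻¹ - w i‖ ≤ ∏ i, ‖z k - w i‖ := by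
      have : ‖z k‖ ^ m = ∏ _i : Fin m, ‖z k‖ := by simp
      rw [this, ← Finset.prod_mul_distrib]
      refine Finset.prod_le_prod (fun _ _ => by positivity) fun i _ => ?_
      refine le_trans (le_of_eq ?_) (norm_one_sub_mul_conj_le (hw i) hk.le)
      rw [← norm_star (z k), ← norm_mul, mul_sub, mul_inv_cancel₀ (star_ne_zero.mpr hζ), mul_comm]
    have h2 : 0 < ∏ i, ‖z k - w i‖ := Finset.prod_pos fun i _ => by
      rw [norm_pos_iff, sub_ne_zero]
      intro he
      exact absurd (hw i) (not_le.mpr (he ▸ hk))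
    rw [h] at h1
    nlinarith
  refine ⟨z, fun k => le_antisymm (hle k) ?_, rfl⟩
  rw [symMap_last, norm_prod] at hp
  rw [← hp, ← Finset.mul_prod_erase Finset.univ _ (Finset.mem_univ k)]
  exact mul_le_of_le_one_right (norm_nonneg _)
    (Finset.prod_le_one (fun _ _ => norm_nonneg _) fun i _ => hle i)

/-! ### The distinguished boundary and the maximum principle. -/

/-- The maximum principle on the polydisc. -/
theorem norm_le_of_polydisc {n : ℕ} {F : (Fin n → ℂ) → ℂ} (hF : Differentiable ℂ F) {M : ℝ}
    (h : ∀ z : Fin n → ℂ, (∀ k, ‖z k‖ = 1) → ‖F z‖ ≤ M) {z : Fin n → ℂ} (hz : ∀ k, ‖z k‖ ≤ 1) :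
    ‖F z‖ ≤ M := by
  -- Here `s` contains the coordinates that may lie inside the disc; the maximum principle in one
  -- variable moves them to the circle one at a time.
  suffices H : ∀ s : Finset (Fin n), ∀ z : Fin n → ℂ, (∀ k, ‖z k‖ ≤ 1) →
      (∀ k ∉ s, ‖z k‖ = 1) → ‖F z‖ ≤ M from H Finset.univ z hz (by simp)
  intro s
  induction s using Finset.induction_on with
  | empty => exact fun z _ hz => h z fun k => hz k (by simp)
  | insert i s hi ih =>
    intro z hz hzs
    have hd : Differentiable ℂ fun t : ℂ => F (Function.update z i t) := by
      refine hF.comp (differentiable_pi.mpr fun k => ?_)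
      by_cases hk : k = i
      · subst hk; simp
      · simp [hk]
    have := Complex.norm_le_of_forall_mem_frontier_norm_le (U := Metric.ball (0 : ℂ) 1)
      Metric.isBounded_ball hd.diffContOnCl (C := M) ?_ (z := z i) ?_
    · simpa using this
    · intro t ht
      rw [frontier_ball _ one_ne_zero, mem_sphere_zero_iff_norm] at ht
      refine ih _ (fun k => ?_) fun k hk => ?_
      · by_cases hki : k = i
        · subst hki; simp [ht]
        · simpa [hki] using hz k
      · by_cases hki : k = i
        · subst hki; simp [ht]
        · simpa [hki] using hzs k (by simp [hki, hk])
    · rw [closure_ball _ one_ne_zero]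
      simpa using hz i

/-- `bΓ_n` is a boundary for the polynomials on `Γ_n`. -/
theorem norm_eval_le_of_bGam {n : ℕ} {p : MvPolynomial (Fin n) ℂ} {M : ℝ}
    (h : ∀ x ∈ bGam n, ‖MvPolynomial.eval x p‖ ≤ M) {x : Fin n → ℂ} (hx : x ∈ Gam n) :
    ‖MvPolynomial.eval x p‖ ≤ M := by
  obtain ⟨z, hz, rfl⟩ := hx
  refine norm_le_of_polydisc (F := fun z => MvPolynomial.eval (symMap n z) p) ?_
    (fun z hz => h _ ⟨z, hz, rfl⟩) hz
  have hs : ∀ i, Differentiable ℂ fun z => symMap n z i := fun i => by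
    unfold symMap
    fun_prop
  simp only [MvPolynomial.eval_eq']
  fun_prop

/-! ### `Γ_n`-unitaries and their restrictions. -/

section
variable {H : Type u} [NormedAddCommGroup H] [InnerProductSpace ℂ H]

@[simp]
theorem joinTuple_castSucc {m : ℕ} (S : Fin m → H →L[ℂ] H) (P : H →L[ℂ] H) (j : Fin m) :
    joinTuple S P j.castSucc = S j := by
  simp [joinTuple]

@[simp]
theorem joinTuple_last {m : ℕ} (S : Fin m → H →L[ℂ] H) (P : H →L[ℂ] H) :
    joinTuple S P (Fin.last m) = P := by
  simp [joinTuple]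

theorem commute_joinTuple {m : ℕ} {S : Fin m → H →L[ℂ] H} {P : H →L[ℂ] H}
    (hS : ∀ i j, Commute (S i) (S j)) (hSP : ∀ i, Commute (S i) P) (i j : Fin (m + 1)) :
    Commute (joinTuple S P i) (joinTuple S P j) := by
  induction i using Fin.lastCases with
  | last =>
    induction j using Fin.lastCases with
    | last => exact Commute.refl _
    | cast j => simpa using (hSP j).symm
  | cast i =>
    induction j using Fin.lastCases with
    | last => simpa using hSP i
    | cast j => simpa using hS i j

theorem commute_scaledTuple {m : ℕ} {S : Fin m → H →L[ℂ] H}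
    (hS : ∀ i j, Commute (S i) (S j)) (i j : Fin m) :
    Commute (scaledTuple S i) (scaledTuple S j) :=
  ((hS i j).smul_left _).smul_right _

end

section
variable {K : Type u} [NormedAddCommGroup K] [InnerProductSpace ℂ K] [CompleteSpace K]

open WeakDual ContinuousLinearMap

theorem scaled_smul_map {A : Type*} [CommCStarAlgebra A] (f : A →⋆ₐ[ℂ] (K →L[ℂ] K)) {m : ℕ}
    (a : Fin (m + 1) → A) {S : Fin m → K →L[ℂ] K} (ha : ∀ j : Fin m, f (a j.castSucc) = S j) :
    (fun j : Fin m => f ((((m : ℂ) - (j : ℕ)) / ((m : ℂ) + 1)) • a j.castSucc)) =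
      scaledTuple S := by
  funext j
  rw [map_smul, ha]
  rfl

theorem character_scaled {A : Type*} [CommCStarAlgebra A] (χ : characterSpace ℂ A) {m : ℕ}
    (a : Fin (m + 1) → A) :
    (fun j : Fin m => χ ((((m : ℂ) - (j : ℕ)) / ((m : ℂ) + 1)) • a j.castSucc)) =
      scaleVec fun i => χ (a i) := by
  funext j
  rw [map_smul]
  rfl

/-- A criterion for `Γ_n`-unitaries. -/
theorem isGamUnitary_joinTuple {m : ℕ} {S : Fin m → K →L[ℂ] K} {P : K →L[ℂ] K}
    (hS : ∀ i j, Commute (S i) (S j)) (hSP : ∀ i, Commute (S i) P)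
    (h1 : adjoint P * P = 1) (h2 : P * adjoint P = 1)
    (hSr : ∀ j, S j = adjoint (S j.rev) * P) (hb : PolyBounded (Gam m) (scaledTuple S)) :
    IsGamUnitary (joinTuple S P) := by
  have hcomm : ∀ j, Commute (S j) (adjoint P) := fun j => by
    have := (hSP j).eq
    calc S j * adjoint P = adjoint P * P * S j * adjoint P := by rw [h1, one_mul]
      _ = adjoint P * (S j * P) * adjoint P := by rw [this, mul_assoc (adjoint P)]
      _ = adjoint P * S j * (P * adjoint P) := by simp only [mul_assoc]
      _ = adjoint P * S j := by rw [h2, mul_one]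
  -- Since `P` is unitary, the relation expresses the adjoint of `S j` through operators commuting
  -- with `S j`; this gives normality.
  have hadj : ∀ j, adjoint (S j) = S j.rev * adjoint P := fun j => by
    conv_rhs => rw [hSr j.rev, Fin.rev_rev, mul_assoc, h2, mul_one]
  have hnormal : ∀ i, IsStarNormal (joinTuple S P i) := fun i => by
    induction i using Fin.lastCases with
    | last =>
      rw [joinTuple_last]
      exact ⟨by rw [star_eq_adjoint, Commute, SemiconjBy, h1, h2]⟩
    | cast j =>
      rw [joinTuple_castSucc]
      refine ⟨?_⟩
      rw [star_eq_adjoint, hadj]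
      exact ((hS _ _).symm.mul_right (hcomm j)).symm
  have hc := commute_joinTuple hS hSP
  refine ⟨hc, hnormal, ?_⟩
  obtain ⟨A, _, f, a, ha, -, hf⟩ := exists_commCStarAlgebra hc hnormal
  have hinj : Function.Injective f := by
    refine (injective_iff_map_eq_zero f).mpr fun b hb0 => ?_
    rw [← norm_eq_zero, ← hf, hb0, norm_zero]
  have haS : ∀ j : Fin m, f (a j.castSucc) = S j := fun j => by rw [ha, joinTuple_castSucc]
  have haP : f (a (Fin.last m)) = P := by rw [ha, joinTuple_last]
  have e1 : star (a (Fin.last m)) * a (Fin.last m) = 1 := hinj <| by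
    rw [map_mul, map_star, haP, map_one, star_eq_adjoint, h1]
  have e2 : ∀ j : Fin m, a j.castSucc = star (a j.rev.castSucc) * a (Fin.last m) := fun j =>
    hinj <| by rw [map_mul, map_star, haP, haS, haS, star_eq_adjoint, ← hSr]
  rw [← funext ha]
  refine taylorSpectrum_subset_of_character f a fun χ => mem_bGam_of_scaleVec ?_ ?_ ?_
  · have := congrArg χ e1
    rw [map_mul, map_star, map_one, mul_comm] at this
    have h3 := (Complex.mul_conj' (χ (a (Fin.last m)))).symm.trans this
    have h4 : ‖χ (a (Fin.last m))‖ ^ 2 = 1 := by exact_mod_cast h3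
    exact (pow_eq_one_iff_of_nonneg (norm_nonneg _) two_ne_zero).mp h4
  · intro j
    have := congrArg χ (e2 j)
    rwa [map_mul, map_star] at this
  -- A character is contractive, so the polynomial bounds of the scaled tuple hold at its character
  -- values; polynomial convexity places these in `Γ_m`.
  · refine polyConvex_Gam m _ fun p M hM => ?_
    rw [← character_scaled, ← map_aeval]
    refine le_trans ?_ (hb p M hM)
    rw [← scaled_smul_map f a haS]
    have h5 := polyEval_eq_aeval (f : A →ₐ[ℂ] (K →L[ℂ] K))
      (fun j : Fin m => (((m : ℂ) - (j : ℕ)) / ((m : ℂ) + 1)) • a j.castSucc) p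
    refine le_trans ?_ (le_of_eq ((hf _).symm.trans (congrArg norm h5.symm)))
    exact NonUnitalStarAlgHom.norm_apply_le χ _

end

section
variable {H : Type u} [NormedAddCommGroup H] [InnerProductSpace ℂ H] [CompleteSpace H]

open WeakDual ContinuousLinearMap

/-- The properties of `Γ_n`-isometries which follow from the spectral theory of the extension. -/
theorem IsGamIsometry.properties {m : ℕ} {S : Fin m → H →L[ℂ] H} {P : H →L[ℂ] H}
    (hS : ∀ i j, Commute (S i) (S j)) (hSP : ∀ i, Commute (S i) P)
    (h : IsGamIsometry (joinTuple S P)) :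
    Isometry P ∧ (∀ j, S j = adjoint (S j.rev) * P) ∧ IsGamContraction (scaledTuple S) ∧
      IsGamContraction (joinTuple S P) := by
  obtain ⟨K, _, _, _, V, N, ⟨hc, hn, hsp⟩, hV⟩ := h
  obtain ⟨A, _, f, a, ha, hu, hf⟩ := exists_commCStarAlgebra hc hn
  have hχ : ∀ χ : characterSpace ℂ A, (fun i => χ (a i)) ∈ bGam (m + 1) := fun χ => by
    refine hsp ?_
    rw [← funext ha]
    exact character_mem_taylorSpectrum f hu a χ
  have e1 : star (a (Fin.last m)) * a (Fin.last m) = 1 := eq_of_forall_character fun χ => by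
    obtain ⟨z, hz, hz'⟩ := hχ χ
    have := norm_symMap_last hz
    rw [hz'] at this
    rw [map_mul, map_star, map_one, mul_comm]
    refine (Complex.mul_conj' (χ (a (Fin.last m)))).trans ?_
    rw [this]
    simp
  have e2 : ∀ j : Fin m, a j.castSucc = star (a j.rev.castSucc) * a (Fin.last m) := fun j =>
    eq_of_forall_character fun χ => by
      obtain ⟨z, hz, hz'⟩ := hχ χ
      have := symMap_castSucc_eq hz j
      rw [hz'] at this
      rw [map_mul, map_star]
      exact this
  have haV : ∀ i x, f (a i) (V x) = V (joinTuple S P i x) := fun i x => by rw [ha, hV]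
  have f1 : adjoint (f (a (Fin.last m))) * f (a (Fin.last m)) = 1 := by
    rw [← star_eq_adjoint, ← map_star, ← map_mul, e1, map_one]
  have f2 : ∀ j : Fin m, f (a j.castSucc) =
      adjoint (f (a j.rev.castSucc)) * f (a (Fin.last m)) := fun j => by
    rw [← star_eq_adjoint, ← map_star, ← map_mul, ← e2]
  refine ⟨?_, fun j => ?_, ⟨commute_scaledTuple hS, ?_⟩, commute_joinTuple hS hSP, ?_⟩
  · refine AddMonoidHomClass.isometry_of_norm P fun x => ?_
    have h3 := haV (Fin.last m) x
    rw [joinTuple_last] at h3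
    rw [← V.norm_map (P x), ← h3]
    have h4 := (norm_map_iff_adjoint_comp_self (f (a (Fin.last m)))).mpr f1 (V x)
    rw [h4, V.norm_map]
  -- Written as `⟨S_i x, y⟩ = ⟨P x, S_{n-i} y⟩` the relation contains no adjoint, so it passes to an
  -- invariant subspace.
  · refine ContinuousLinearMap.ext fun x => ext_inner_right ℂ fun y => ?_
    rw [mul_apply_eq_comp, adjoint_inner_left, ← V.inner_map_map, ← V.inner_map_map (P x)]
    have h3 := haV j.castSucc x
    have h4 := haV j.rev.castSucc y
    have h5 := haV (Fin.last m) x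
    rw [joinTuple_castSucc] at h3 h4
    rw [joinTuple_last] at h5
    rw [← h3, ← h4, ← h5, f2 j, mul_apply_eq_comp, adjoint_inner_left]
  · refine isSpectralSet_of_intertwine (polyConvex_Gam m) (isCompact_Gam m) (Gam_nonempty m)
      (commute_scaledTuple hS) V f hf
      (fun j : Fin m => (((m : ℂ) - (j : ℕ)) / ((m : ℂ) + 1)) • a j.castSucc) ?_ ?_
    · intro j x
      have h3 := haV j.castSucc x
      rw [joinTuple_castSucc] at h3
      rw [map_smul, smul_apply, h3, scaledTuple,
        smul_apply, map_smul]
    · intro χ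
      rw [character_scaled]
      exact scaleVec_mem_Gam (bGam_subset_Gam _ (hχ χ))
  · exact isSpectralSet_of_intertwine (polyConvex_Gam _) (isCompact_Gam _) (Gam_nonempty _)
      (commute_joinTuple hS hSP) V f hf a haV fun χ => bGam_subset_Gam _ (hχ χ)

end

/-! ### The minimal unitary extension of an isometry and of its commutant. -/

section
variable {H : Type u} [NormedAddCommGroup H] [InnerProductSpace ℂ H]

/-- The sequences `y` which eventually satisfy `y (j + 1) = P (y j)`. -/
def orbitSubmodule (P : H →L[ℂ] H) : Submodule ℂ (ℕ → H) where
  carrier := {y | ∃ k, ∀ j ≥ k, y (j + 1) = P (y j)}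
  add_mem' := by
    rintro y z ⟨k, hk⟩ ⟨l, hl⟩
    refine ⟨max k l, fun j hj => ?_⟩
    simp [hk j (le_of_max_le_left hj), hl j (le_of_max_le_right hj)]
  zero_mem' := ⟨0, by simp⟩
  smul_mem' := by
    rintro c y ⟨k, hk⟩
    exact ⟨k, fun j hj => by simp [hk j hj]⟩

/-- The space of eventual orbits of an isometry. -/
def OrbitSpace (P : H →ₗᵢ[ℂ] H) : Type u := orbitSubmodule P.toContinuousLinearMap

namespace OrbitSpace

variable {P : H →ₗᵢ[ℂ] H}

instance : AddCommGroup (OrbitSpace P) :=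
  inferInstanceAs (AddCommGroup (orbitSubmodule P.toContinuousLinearMap))

instance : Module ℂ (OrbitSpace P) :=
  inferInstanceAs (Module ℂ (orbitSubmodule P.toContinuousLinearMap))

/-- The terms of an eventual orbit. -/
def val : OrbitSpace P →ₗ[ℂ] (ℕ → H) := (orbitSubmodule P.toContinuousLinearMap).subtype

theorem exists_val_succ (y : OrbitSpace P) : ∃ k, ∀ j ≥ k, val y (j + 1) = P (val y j) := y.2

/-- An eventual orbit with given terms. -/
def mk (y : ℕ → H) (h : ∃ k, ∀ j ≥ k, y (j + 1) = P (y j)) : OrbitSpace P := ⟨y, h⟩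

@[simp]
theorem val_mk (y : ℕ → H) (h : ∃ k, ∀ j ≥ k, y (j + 1) = P (y j)) :
    val (mk y h : OrbitSpace P) = y := rfl

/-- The isometry preserves inner products, so these are constant once both sequences are orbits. The
sequence `y` stands for `U⁻ʲ (y j)` with `j` large, where `U` is the unitary extension. -/
theorem exists_inner_eq (y z : OrbitSpace P) :
    ∃ c : ℂ, ∀ᶠ j in Filter.atTop, inner ℂ (val y j) (val z j) = c := by
  obtain ⟨k, hk⟩ := y.exists_val_succ
  obtain ⟨l, hl⟩ := z.exists_val_succ
  refine ⟨inner ℂ (val y (max k l)) (val z (max k l)), ?_⟩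
  filter_upwards [Filter.eventually_ge_atTop (max k l)] with j hj
  induction j, hj using Nat.le_induction with
  | base => rfl
  | succ j hj ih =>
    rw [hk j (le_of_max_le_left hj), hl j (le_of_max_le_right hj), P.inner_map_map, ih]

/-- The eventual inner product. -/
@[reducible] def core (P : H →ₗᵢ[ℂ] H) : PreInnerProductSpace.Core ℂ (OrbitSpace P) where
  inner y z := (exists_inner_eq y z).choose
  conj_inner_symm y z := by
    obtain ⟨j, h1, h2⟩ := ((exists_inner_eq y z).choose_spec.and
      (exists_inner_eq z y).choose_spec).exists
    rw [← h1, ← h2, inner_conj_symm]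
  re_inner_nonneg y := by
    obtain ⟨j, h1⟩ := (exists_inner_eq y y).choose_spec.exists
    rw [← h1]
    exact inner_self_nonneg
  add_left x y z := by
    obtain ⟨j, ⟨h1, h2⟩, h3⟩ := (((exists_inner_eq (x + y) z).choose_spec.and
      (exists_inner_eq x z).choose_spec).and (exists_inner_eq y z).choose_spec).exists
    rw [← h1, ← h2, ← h3, map_add, Pi.add_apply, inner_add_left]
  smul_left x y r := by
    obtain ⟨j, h1, h2⟩ := ((exists_inner_eq (r • x) y).choose_spec.and
      (exists_inner_eq x y).choose_spec).exists
    rw [← h1, ← h2, map_smul, Pi.smul_apply, inner_smul_left]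

/-- Only a seminorm: sequences that agree eventually are at distance zero. The completion identifies
them. -/
instance : SeminormedAddCommGroup (OrbitSpace P) :=
  @InnerProductSpace.Core.toSeminormedAddCommGroup ℂ (OrbitSpace P) _ _ _ (core P)

instance : InnerProductSpace ℂ (OrbitSpace P) := InnerProductSpace.ofCore (core P)

theorem eventually_inner (y z : OrbitSpace P) :
    ∀ᶠ j in Filter.atTop, inner ℂ (val y j) (val z j) = inner ℂ y z :=
  (exists_inner_eq y z).choose_spec

theorem eventually_norm (y : OrbitSpace P) : ∀ᶠ j in Filter.atTop, ‖val y j‖ = ‖y‖ := by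
  filter_upwards [eventually_inner y y] with j hj
  rw [@norm_eq_sqrt_re_inner ℂ, @norm_eq_sqrt_re_inner ℂ _ _ _ _ y, hj]

theorem norm_sub_eq_zero {y z : OrbitSpace P}
    (h : ∀ᶠ j in Filter.atTop, val y j = val z j) : ‖y - z‖ = 0 := by
  obtain ⟨j, h1, h2⟩ := (h.and (eventually_norm (y - z))).exists
  rw [← h2, map_sub, Pi.sub_apply, h1, sub_self, norm_zero]

/-- The action of an operator commuting with `P`. -/
def map (T : H →L[ℂ] H) (hT : ∀ x, T (P x) = P (T x)) : OrbitSpace P →L[ℂ] OrbitSpace P :=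
  LinearMap.mkContinuous
    { toFun := fun y => mk (fun j => T (val y j)) (by
        obtain ⟨k, hk⟩ := y.exists_val_succ
        exact ⟨k, fun j hj => by rw [hk j hj, hT]⟩)
      map_add' := fun y z => Subtype.ext (funext fun j => by
        change T (val (y + z) j) = T (val y j) + T (val z j)
        simp)
      map_smul' := fun c y => Subtype.ext (funext fun j => by
        change T (val (c • y) j) = c • T (val y j)
        simp) } ‖T‖ fun y => by
    obtain ⟨j, h1, h2⟩ := ((eventually_norm y).and (eventually_norm
      (mk (P := P) (fun j => T (val y j)) (by
        obtain ⟨k, hk⟩ := y.exists_val_succ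
        exact ⟨k, fun j hj => by rw [hk j hj, hT]⟩)))).exists
    rw [← h1]
    refine (le_of_eq h2.symm).trans ?_
    exact T.le_opNorm _

theorem norm_map_le (T : H →L[ℂ] H) (hT : ∀ x, T (P x) = P (T x)) : ‖map T hT‖ ≤ ‖T‖ :=
  LinearMap.mkContinuous_norm_le _ (norm_nonneg _) _

@[simp]
theorem val_map (T : H →L[ℂ] H) (hT : ∀ x, T (P x) = P (T x)) (y : OrbitSpace P) (j : ℕ) :
    val (map T hT y) j = T (val y j) := rfl

/-- The right shift. -/
def shift (y : OrbitSpace P) : OrbitSpace P :=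
  -- Truncated subtraction repeats `y 0` at the start, which is harmless since only late terms
  -- count.
  mk (fun j => val y (j - 1)) (by
    obtain ⟨k, hk⟩ := y.exists_val_succ
    refine ⟨k + 1, fun j hj => ?_⟩
    obtain ⟨i, rfl⟩ : ∃ i, j = i + 1 := ⟨j - 1, by omega⟩
    simpa using hk i (by omega))

theorem eventually_map_shift (hP : ∀ x, P.toContinuousLinearMap (P x) =
    P (P.toContinuousLinearMap x)) (y : OrbitSpace P) :
    ∀ᶠ j in Filter.atTop, val (map P.toContinuousLinearMap hP (shift y)) j = val y j := by
  obtain ⟨k, hk⟩ := y.exists_val_succ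
  filter_upwards [Filter.eventually_ge_atTop (k + 1)] with j hj
  obtain ⟨i, rfl⟩ : ∃ i, j = i + 1 := ⟨j - 1, by omega⟩
  exact (hk i (by omega)).symm

/-- The embedding of `H`. -/
def incl (P : H →ₗᵢ[ℂ] H) : H →ₗᵢ[ℂ] OrbitSpace P where
  toFun x := mk (fun j => P^[j] x) ⟨0, fun j _ => Function.iterate_succ_apply' _ _ _⟩
  map_add' x y := Subtype.ext (funext fun j => by
    change P^[j] (x + y) = P^[j] x + P^[j] y
    exact iterate_map_add P j x y)
  map_smul' c x := Subtype.ext (funext fun j => by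
    change P^[j] (c • x) = c • P^[j] x
    induction j with
    | zero => rfl
    | succ j ih =>
      rw [Function.iterate_succ_apply', Function.iterate_succ_apply', ih, map_smul])
  norm_map' x := by
    obtain ⟨j, h⟩ := (eventually_norm (mk (P := P) (fun j => P^[j] x)
      ⟨0, fun j _ => Function.iterate_succ_apply' _ _ _⟩)).exists
    refine h.symm.trans ?_
    rw [val_mk]
    clear h
    induction j with
    | zero => rfl
    | succ j ih => rw [Function.iterate_succ_apply', P.norm_map, ih]

end OrbitSpace

end

section
variable {H : Type u} [NormedAddCommGroup H] [InnerProductSpace ℂ H]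

open UniformSpace ContinuousLinearMap

theorem completion_clm_ext {E : Type*} [SeminormedAddCommGroup E] [InnerProductSpace ℂ E]
    {F G : Completion E →L[ℂ] Completion E} (h : ∀ y : E, F y = G y) : F = G := by
  refine ContinuousLinearMap.ext fun x => ?_
  induction x using Completion.induction_on with
  | hp => exact isClosed_eq F.continuous G.continuous
  | ih y => exact h y

theorem norm_completion_le {E : Type*} [SeminormedAddCommGroup E] [InnerProductSpace ℂ E]
    {F : E →L[ℂ] E} {c : ℝ} (hc : 0 ≤ c) (h : ‖F‖ ≤ c) : ‖F.completion‖ ≤ c := by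
  refine ContinuousLinearMap.opNorm_le_bound _ hc fun x => ?_
  induction x using Completion.induction_on with
  | hp => exact isClosed_le (by fun_prop) (by fun_prop)
  | ih y =>
    rw [completion_apply_coe, Completion.norm_coe, Completion.norm_coe]
    exact F.le_of_opNorm_le h y

namespace OrbitSpace

variable {P : H →ₗᵢ[ℂ] H}

theorem commute_apply (T : Subalgebra.centralizer ℂ {P.toContinuousLinearMap}) (x : H) :
    (T : H →L[ℂ] H) (P x) = P ((T : H →L[ℂ] H) x) :=
  (congrArg (fun A : H →L[ℂ] H => A x)
    (Subalgebra.mem_centralizer_iff ℂ |>.mp T.2 _ rfl)).symm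

/-- The action of the commutant of `P` on the completed space of eventual orbits. -/
def extHom (P : H →ₗᵢ[ℂ] H) : Subalgebra.centralizer ℂ {P.toContinuousLinearMap} →ₐ[ℂ]
    (Completion (OrbitSpace P) →L[ℂ] Completion (OrbitSpace P)) :=
  AlgHom.ofLinearMap
    { toFun := fun T => (map (T : H →L[ℂ] H) (commute_apply T)).completion
      map_add' := fun S T => completion_clm_ext fun y => by
        rw [add_apply]
        simp only [completion_apply_coe]
        rw [← Completion.coe_add]
        rfl
      map_smul' := fun c T => completion_clm_ext fun y => by
        rw [RingHom.id_apply, smul_apply]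
        simp only [completion_apply_coe]
        rw [← Completion.coe_smul]
        rfl }
    (completion_clm_ext fun y => by
      rw [LinearMap.coe_mk, AddHom.coe_mk, completion_apply_coe]
      rfl)
    fun S T => completion_clm_ext fun y => by
      rw [mul_apply_eq_comp]
      simp only [LinearMap.coe_mk, AddHom.coe_mk, completion_apply_coe]
      rfl

theorem extHom_coe (T : Subalgebra.centralizer ℂ {P.toContinuousLinearMap}) (y : OrbitSpace P) :
    extHom P T (y : Completion (OrbitSpace P)) =
      ((map (T : H →L[ℂ] H) (commute_apply T) y : OrbitSpace P) : Completion (OrbitSpace P)) :=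
  completion_apply_coe _ _

end OrbitSpace

open OrbitSpace

/-- The isometry `P` as an element of its commutant. -/
def selfCommutant (P : H →ₗᵢ[ℂ] H) : Subalgebra.centralizer ℂ {P.toContinuousLinearMap} :=
  ⟨P.toContinuousLinearMap, by rw [Subalgebra.mem_centralizer_iff]; rintro _ rfl; rfl⟩

/-- The minimal unitary extension of an isometry, with the extension of the commutant. -/
theorem exists_unitary_extension [CompleteSpace H] (P : H →ₗᵢ[ℂ] H) :
    ∃ (K : Type u) (_ : NormedAddCommGroup K) (_ : InnerProductSpace ℂ K) (_ : CompleteSpace K)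
      (V : H →ₗᵢ[ℂ] K)
      (Φ : Subalgebra.centralizer ℂ {P.toContinuousLinearMap} →ₐ[ℂ] (K →L[ℂ] K)),
      (∀ T x, Φ T (V x) = V ((T : H →L[ℂ] H) x)) ∧ (∀ T, ‖Φ T‖ ≤ ‖(T : H →L[ℂ] H)‖) ∧
      adjoint (Φ (selfCommutant P)) * Φ (selfCommutant P) = 1 ∧
      Φ (selfCommutant P) * adjoint (Φ (selfCommutant P)) = 1 ∧
      ∀ A B : Subalgebra.centralizer ℂ {P.toContinuousLinearMap},
        (A : H →L[ℂ] H) = adjoint (B : H →L[ℂ] H) * P.toContinuousLinearMap →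
        Φ A = adjoint (Φ B) * Φ (selfCommutant P) := by
  have iso : adjoint (extHom P (selfCommutant P)) * extHom P (selfCommutant P) = 1 := by
    refine (norm_map_iff_adjoint_comp_self _).mp fun x => ?_
    induction x using Completion.induction_on with
    | hp => exact isClosed_eq (by fun_prop) (by fun_prop)
    | ih y =>
      rw [extHom_coe, Completion.norm_coe, Completion.norm_coe]
      obtain ⟨j, h1, h2⟩ := ((eventually_norm y).and (eventually_norm
        (map _ (commute_apply (selfCommutant P)) y))).exists
      rw [← h1, ← h2, val_map]
      exact P.norm_map _
  refine ⟨Completion (OrbitSpace P), inferInstance, inferInstance, inferInstance,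
    Completion.toComplₗᵢ.comp (incl P), extHom P, ?_, ?_, iso, ?_, ?_⟩
  · intro T x
    change extHom P T ((incl P x : OrbitSpace P) : Completion (OrbitSpace P)) =
      ((incl P ((T : H →L[ℂ] H) x) : OrbitSpace P) : Completion (OrbitSpace P))
    rw [extHom_coe]
    refine congrArg _ (Subtype.ext (funext fun j => ?_))
    change (T : H →L[ℂ] H) (P^[j] x) = P^[j] ((T : H →L[ℂ] H) x)
    induction j with
    | zero => rfl
    | succ j ih =>
      rw [Function.iterate_succ_apply', Function.iterate_succ_apply', commute_apply, ih]
  · exact fun T => norm_completion_le (norm_nonneg _) (norm_map_le _ _)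
  · refine completion_clm_ext fun y => ?_
    -- The shift inverts the extended isometry up to a null vector, so its range contains the dense
    -- image of `OrbitSpace P`; a right inverse follows from the left one.
    have hy : (y : Completion (OrbitSpace P)) =
        extHom P (selfCommutant P) (shift y : OrbitSpace P) := by
      rw [extHom_coe, ← sub_eq_zero, ← norm_eq_zero, ← Completion.coe_sub, Completion.norm_coe,
        norm_sub_rev]
      exact norm_sub_eq_zero (eventually_map_shift (commute_apply (selfCommutant P)) y)
    rw [hy, mul_apply_eq_comp, ← mul_apply_eq_comp (adjoint _), iso]
    rfl
  · intro A B hAB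
    refine completion_clm_ext fun y => ext_inner_right ℂ fun x => ?_
    induction x using Completion.induction_on with
    | hp => exact isClosed_eq (by fun_prop) (by fun_prop)
    | ih z =>
      rw [mul_apply_eq_comp, adjoint_inner_left, extHom_coe, extHom_coe, extHom_coe,
        Completion.inner_coe, Completion.inner_coe]
      -- At one late index both inner products are computed in `H`, where the relation is available.
      obtain ⟨j, h1, h2⟩ := ((eventually_inner (map _ (commute_apply A) y) z).and
        (eventually_inner (map _ (commute_apply (selfCommutant P)) y)
          (map _ (commute_apply B) z))).exists
      rw [← h1, ← h2, val_map, val_map, val_map, hAB, mul_apply_eq_comp, adjoint_inner_left]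
      rfl

end

/-! ### From operator inequalities to `Γ_n`-isometries. -/

section

open ContinuousLinearMap

section
variable {H : Type u} [NormedAddCommGroup H] [InnerProductSpace ℂ H]

theorem polyEval_map {B : Type*} [Ring B] [Algebra ℂ B] (f : B →ₐ[ℂ] (H →L[ℂ] H)) {n : ℕ}
    (b : Fin n → B) (p : MvPolynomial (Fin n) ℂ) :
    polyEval (fun i => f (b i)) p =
      f (∑ m ∈ p.support, p.coeff m • (List.ofFn fun i => b i ^ m i).prod) := by
  rw [map_sum]
  refine Finset.sum_congr rfl fun m _ => ?_
  rw [map_smul, map_list_prod, List.map_ofFn]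
  congr 2
  simp [Function.comp_def]

/-- Polynomial bounds pass to restrictions. -/
theorem PolyBounded.of_intertwine {G : Type*} [NormedAddCommGroup G] [InnerProductSpace ℂ G] {n : ℕ}
    {X : Set (Fin n → ℂ)} (hX : X.Nonempty) {T : Fin n → H →L[ℂ] H} {T' : Fin n → G →L[ℂ] G}
    (hT : ∀ i j, Commute (T i) (T j)) (hT' : ∀ i j, Commute (T' i) (T' j)) (V : G →ₗᵢ[ℂ] H)
    (hV : ∀ i x, T i (V x) = V (T' i x)) (h : PolyBounded X T) : PolyBounded X T' := by
  intro p M hM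
  obtain ⟨x, hx⟩ := hX
  refine ContinuousLinearMap.opNorm_le_bound _ ((norm_nonneg _).trans (hM x hx)) fun y => ?_
  have := polyEval_intertwine hT' hT V.toLinearMap hV p y
  have h2 : ‖polyEval T' p y‖ = ‖polyEval T p (V y)‖ :=
    (V.norm_map _).symm.trans (congrArg norm this.symm)
  rw [h2, ← V.norm_map y]
  exact le_of_opNorm_le _ (h p M hM) _

/-- A polynomial bounded by `M` on `Γ_m` pulls back along `scaleVec` to one bounded by `M` on
`Γ_{m+1}`, by Gauss–Lucas. -/
theorem polyBounded_scaledTuple {m : ℕ} {S : Fin m → H →L[ℂ] H} {P : H →L[ℂ] H}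
    (hS : ∀ i j, Commute (S i) (S j)) (hSP : ∀ i, Commute (S i) P)
    (h : PolyBounded (Gam (m + 1)) (joinTuple S P)) : PolyBounded (Gam m) (scaledTuple S) := by
  intro p M hM
  obtain ⟨f, hf, hf'⟩ := exists_polyEval_hom (commute_joinTuple hS hSP)
  let b : Fin m → MvPolynomial (Fin (m + 1)) ℂ := fun j =>
    (((m : ℂ) - (j : ℕ)) / ((m : ℂ) + 1)) • MvPolynomial.X j.castSucc
  have hb : (fun j => f (b j)) = scaledTuple S := by
    funext j
    simp only [b]
    rw [map_smul, hf, joinTuple_castSucc]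
    rfl
  rw [← hb, polyEval_eq_aeval, ← hf']
  refine h _ _ fun x hx => ?_
  refine le_of_eq_of_le ?_ (hM _ (scaleVec_mem_Gam hx))
  rw [← MvPolynomial.coe_aeval_eq_eval, ← MvPolynomial.coe_aeval_eq_eval]
  change ‖MvPolynomial.aeval x (MvPolynomial.aeval b p)‖ = ‖MvPolynomial.aeval (scaleVec x) p‖
  rw [MvPolynomial.comp_aeval_apply]
  congr 3
  funext j
  simp [b, scaleVec]

end

section
variable {H : Type u} [NormedAddCommGroup H] [InnerProductSpace ℂ H] [CompleteSpace H]

theorem isGamIsometry_of_polyBounded {m : ℕ} {S : Fin m → H →L[ℂ] H} {P : H →L[ℂ] H}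
    (hS : ∀ i j, Commute (S i) (S j)) (hSP : ∀ i, Commute (S i) P) (hP : Isometry P)
    (hSr : ∀ j, S j = adjoint (S j.rev) * P) (hb : PolyBounded (Gam m) (scaledTuple S)) :
    IsGamIsometry (joinTuple S P) := by
  obtain ⟨P', rfl⟩ : ∃ P' : H →ₗᵢ[ℂ] H, P = P'.toContinuousLinearMap :=
    ⟨⟨P.toLinearMap, (AddMonoidHomClass.isometry_iff_norm P).mp hP⟩, rfl⟩
  obtain ⟨K, _, _, _, V, Φ, hV, hΦ, h1, h2, h3⟩ := exists_unitary_extension P'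
  let s : Fin m → Subalgebra.centralizer ℂ {P'.toContinuousLinearMap} := fun j =>
    ⟨S j, by rw [Subalgebra.mem_centralizer_iff]; rintro _ rfl; exact (hSP j).eq.symm⟩
  have comm : ∀ i j, s i * s j = s j * s i := fun i j => Subtype.ext (hS i j).eq
  have commP : ∀ i, s i * selfCommutant P' = selfCommutant P' * s i := fun i =>
    Subtype.ext (hSP i).eq
  have hU : IsGamUnitary (joinTuple (fun j => Φ (s j)) (Φ (selfCommutant P'))) := by
    refine isGamUnitary_joinTuple (fun i j => ?_) (fun i => ?_) h1 h2
      (fun j => h3 _ _ (hSr j)) fun p M hM => ?_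
    · rw [Commute, SemiconjBy, ← map_mul, comm, map_mul]
    · rw [Commute, SemiconjBy, ← map_mul, commP, map_mul]
    -- A polynomial in the extended operators is the extension of the polynomial, and the extension
    -- map is contractive.
    · let b : Fin m → Subalgebra.centralizer ℂ {P'.toContinuousLinearMap} := fun j =>
        (((m : ℂ) - (j : ℕ)) / ((m : ℂ) + 1)) • s j
      have e1 : scaledTuple (fun j => Φ (s j)) = fun j => Φ (b j) := by
        funext j
        simp only [b]
        rw [map_smul]
        rfl
      have e2 : scaledTuple S = fun j => (Subalgebra.centralizer ℂ
        {P'.toContinuousLinearMap}).val (b j) := rfl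
      have h4 := hb p M hM
      rw [e2, polyEval_map] at h4
      rw [e1, polyEval_map]
      exact (hΦ _).trans h4
  refine ⟨K, _, _, _, V, _, hU, fun i x => ?_⟩
  induction i using Fin.lastCases with
  | last =>
    rw [joinTuple_last, joinTuple_last]
    exact hV _ x
  | cast j =>
    rw [joinTuple_castSucc, joinTuple_castSucc]
    exact hV _ x

/-- On `bΓ_n` the perturbation equals `p (a conj(s) - conj(a) s)`, and the bracket is purely
imaginary. Hence there is no term of first order in `ε`. -/
theorem norm_sq_eq_of_mem_bGam {m : ℕ} {x : Fin (m + 1) → ℂ} (hx : x ∈ bGam (m + 1)) (j : Fin m)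
    (a : ℂ) (ε : ℝ) :
    ‖x (Fin.last m) + ε * (a * x j.rev.castSucc - star a * (x (Fin.last m) * x j.castSucc))‖ ^ 2 =
      1 + ε ^ 2 * ‖a * x j.rev.castSucc - star a * (x (Fin.last m) * x j.castSucc)‖ ^ 2 := by
  obtain ⟨z, hz, rfl⟩ := hx
  have h1 := norm_symMap_last hz
  have h2 := symMap_castSucc_eq hz j.rev
  rw [Fin.rev_rev] at h2
  generalize symMap (m + 1) z (Fin.last m) = p at *
  generalize symMap (m + 1) z j.castSucc = s at *
  rw [h2]
  have h3 : a * (star s * p) - star a * (p * s) = p * (a * star s - star a * s) := by ring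
  have h4 : p + ε * (p * (a * star s - star a * s)) = p * (1 + ε * (a * star s - star a * s)) := by
    ring
  rw [h3, h4, norm_mul, norm_mul, h1, one_mul, one_mul, ← Complex.normSq_eq_norm_sq,
    ← Complex.normSq_eq_norm_sq, Complex.normSq_apply, Complex.normSq_apply]
  simp
  ring

/-- A `Γ_n`-contraction whose last entry is an isometry satisfies the relations of a
`Γ_n`-isometry: first order variation of the von Neumann inequality. -/
theorem eq_adjoint_mul_of_polyBounded {m : ℕ} {S : Fin m → H →L[ℂ] H} {P : H →L[ℂ] H}
    (hS : ∀ i j, Commute (S i) (S j)) (hSP : ∀ i, Commute (S i) P) (hP : Isometry P)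
    (h : PolyBounded (Gam (m + 1)) (joinTuple S P)) (j : Fin m) :
    S j = adjoint (S j.rev) * P := by
  have hPn : ∀ x, ‖P x‖ = ‖x‖ := (AddMonoidHomClass.isometry_iff_norm P).mp hP
  have hPi : ∀ x y, inner ℂ (P x) (P y) = inner ℂ x y :=
    (⟨P.toLinearMap, hPn⟩ : H →ₗᵢ[ℂ] H).inner_map_map
  obtain ⟨f, hf, hf'⟩ := exists_polyEval_hom (commute_joinTuple hS hSP)
  have key : ∀ (a : ℂ) (x : H), (inner ℂ (P x) (a • S j.rev x - star a • P (S j x))).re = 0 := by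
    intro a x
    set g : MvPolynomial (Fin (m + 1)) ℂ := MvPolynomial.C a * MvPolynomial.X j.rev.castSucc -
      MvPolynomial.C (star a) * (MvPolynomial.X (Fin.last m) * MvPolynomial.X j.castSucc) with hg
    have hge : ∀ y, MvPolynomial.eval y g =
        a * y j.rev.castSucc - star a * (y (Fin.last m) * y j.castSucc) := fun y => by
      simp [hg]
    obtain ⟨C, hC⟩ := (isCompact_Gam (m + 1)).exists_bound_of_continuousOn
      (MvPolynomial.continuous_eval g).continuousOn
    have hfg : f g x = a • S j.rev x - star a • P (S j x) := by
      rw [hg, map_sub, map_mul, map_mul, map_mul, hf, hf, hf, ← MvPolynomial.algebraMap_eq,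
        AlgHom.commutes, AlgHom.commutes, joinTuple_castSucc, joinTuple_castSucc, joinTuple_last]
      simp [Algebra.algebraMap_eq_smul_one]
    rw [← hfg]
    -- By the maximum principle the estimate on `bΓ_n` suffices. As `‖P x‖ = ‖x‖`, comparing the
    -- terms linear in `ε` will kill the real part of the inner product.
    have bound : ∀ ε : ℝ, ‖P x + (ε : ℂ) • f g x‖ ^ 2 ≤ (1 + ε ^ 2 * C ^ 2) * ‖x‖ ^ 2 := by
      intro ε
      have h1 := h (MvPolynomial.X (Fin.last m) + MvPolynomial.C (ε : ℂ) * g)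
        (Real.sqrt (1 + ε ^ 2 * C ^ 2)) fun y hy => norm_eval_le_of_bGam (fun y hy => ?_) hy
      · rw [hf', map_add, map_mul, hf, joinTuple_last, ← MvPolynomial.algebraMap_eq,
          AlgHom.commutes] at h1
        have h2 := le_of_opNorm_le _ h1 x
        have h3 : (P + algebraMap ℂ (H →L[ℂ] H) ε * f g) x = P x + (ε : ℂ) • f g x := by
          simp [Algebra.algebraMap_eq_smul_one]
        rw [h3] at h2
        calc _ ≤ _ := pow_le_pow_left₀ (norm_nonneg _) h2 2
          _ = _ := by rw [mul_pow, Real.sq_sqrt (by positivity)]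
      · refine Real.le_sqrt_of_sq_le ?_
        have h4 := norm_sq_eq_of_mem_bGam hy j a ε
        rw [← hge] at h4
        rw [map_add, map_mul, MvPolynomial.eval_X, MvPolynomial.eval_C, h4]
        have h5 := hC y (bGam_subset_Gam _ hy)
        gcongr
    have lin : ∀ ε : ℝ, 2 * ε * (inner ℂ (P x) (f g x)).re ≤ ε ^ 2 * (C ^ 2 * ‖x‖ ^ 2) := by
      intro ε
      have h1 := bound ε
      rw [@norm_add_sq ℂ, hPn, inner_smul_right] at h1
      have h2 : RCLike.re ((ε : ℂ) * inner ℂ (P x) (f g x)) =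
          ε * (inner ℂ (P x) (f g x)).re := by
        simp
      rw [h2] at h1
      nlinarith [sq_nonneg ‖(ε : ℂ) • f g x‖]
    set r := (inner ℂ (P x) (f g x)).re
    set D := C ^ 2 * ‖x‖ ^ 2
    have hD : 0 ≤ D := by positivity
    -- A near-optimal `ε`; the summand `1` avoids dividing by zero when `D = 0`.
    have h1 := lin (r / (D + 1))
    have h2 : 2 * (r / (D + 1)) * r = 2 * (D + 1) * (r / (D + 1)) ^ 2 := by
      field_simp
    rw [h2] at h1
    have h3 : (r / (D + 1)) ^ 2 = 0 := by nlinarith [sq_nonneg (r / (D + 1))]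
    have h4 : r / (D + 1) = 0 := by simpa using h3
    rcases div_eq_zero_iff.mp h4 with h5 | h5
    · exact h5
    · linarith
  have h1 : ∀ x, inner ℂ (S j x) x = inner ℂ ((adjoint (S j.rev) * P) x) x := by
    intro x
    have hre : (inner ℂ (S j x) x).re = (inner ℂ x (S j x)).re := by
      rw [← inner_conj_symm, Complex.conj_re]
    have him : (inner ℂ (S j x) x).im = -(inner ℂ x (S j x)).im := by
      rw [← inner_conj_symm, Complex.conj_im]
    rw [mul_apply_eq_comp, adjoint_inner_left]
    -- The choices `a = 1` and `a = I` give the real and the imaginary part; equality of quadratic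
    -- forms then yields equality of operators over `ℂ`.
    have k1 := key 1 x
    have k2 := key Complex.I x
    simp only [inner_sub_right, inner_smul_right, hPi] at k1 k2
    refine Complex.ext ?_ ?_
    · simp at k1
      linarith
    · simp at k2
      linarith
  exact ContinuousLinearMap.coe_injective ((ext_inner_map _ _).mp h1)

end

/-! ### Operator pencils. -/

section
variable {H : Type u} [NormedAddCommGroup H] [InnerProductSpace ℂ H] [CompleteSpace H]

/-- The Fourier expansion of the pencil. -/
theorem pencil_expansion (n : ℕ) (S R P : H →L[ℂ] H) {β : ℂ} (hβ : ‖β‖ = 1) :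
    star ((n : ℂ) • (1 : H →L[ℂ] H) - β • S) * ((n : ℂ) • (1 : H →L[ℂ] H) - β • S) -
      star (((n : ℂ) * β) • P - R) * (((n : ℂ) * β) • P - R) =
    (((n : ℂ) ^ 2) • (1 - star P * P) + (star S * S - star R * R)) +
      (n : ℂ) • (β • (star R * P - S) + star β • star (star R * P - S)) := by
  have h1 : β * star β = 1 := by
    have := Complex.mul_conj' β
    rw [hβ] at this
    simpa using this
  have hn : star (n : ℂ) = n := by simp
  simp only [star_sub, star_smul, star_one, star_mul, star_star, hn, sub_mul, mul_sub,
    smul_mul_assoc, mul_smul_comm, one_mul, mul_one, smul_sub, smul_add, smul_smul]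
  have h3 : (n : ℂ) * β * (star β * n) = (n : ℂ) ^ 2 := by
    linear_combination (n : ℂ) ^ 2 * h1
  simp only [h1, h3, one_smul]
  module

/-- Three points of the circle suffice: `1` and `-1` isolate `E` and `D + star D`, and `I` then
gives `D - star D`. -/
theorem fourier_eq_zero {E D : H →L[ℂ] H} {n : ℕ} (hn : n ≠ 0)
    (h : ∀ β : ℂ, ‖β‖ = 1 → E + (n : ℂ) • (β • D + star β • star D) = 0) : E = 0 ∧ D = 0 := by
  have hn' : (n : ℂ) ≠ 0 := by exact_mod_cast hn
  have h1 := h 1 (by simp)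
  have h2 := h (-1) (by simp)
  have h3 := h Complex.I (by simp)
  simp only [star_one, star_neg, one_smul, neg_smul] at h1 h2
  have hE : (2 : ℂ) • E = 0 := by
    calc (2 : ℂ) • E = (E + (n : ℂ) • (D + star D)) + (E + (n : ℂ) • (-D + -star D)) := by module
      _ = 0 := by rw [h1, h2, add_zero]
  have hE0 : E = 0 := (smul_eq_zero.mp hE).resolve_left two_ne_zero
  rw [hE0, zero_add] at h1 h3
  have h4 : D + star D = 0 := (smul_eq_zero.mp h1).resolve_left hn'
  have h5 := (smul_eq_zero.mp h3).resolve_left hn'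
  have h6 : star Complex.I = -Complex.I := Complex.conj_I
  rw [h6, neg_smul, ← sub_eq_add_neg, ← smul_sub] at h5
  have h7 := (smul_eq_zero.mp h5).resolve_left Complex.I_ne_zero
  refine ⟨hE0, ?_⟩
  have h8 : (2 : ℂ) • D = 0 := by
    calc (2 : ℂ) • D = (D + star D) + (D - star D) := by module
      _ = 0 := by rw [h4, h7, add_zero]
  exact (smul_eq_zero.mp h8).resolve_left two_ne_zero

/-- The relations of a `Γ_n`-isometry are equivalent to the vanishing of the pencils. -/
theorem relations_iff_pencil {m : ℕ} (hm : 1 ≤ m) {S : Fin m → H →L[ℂ] H} {P : H →L[ℂ] H}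
    (hS : ∀ i j, Commute (S i) (S j)) :
    (Isometry P ∧ ∀ j, S j = adjoint (S j.rev) * P) ↔
    ∀ j, ∀ β : ℂ, ‖β‖ = 1 →
      star (((m : ℂ) + 1) • (1 : H →L[ℂ] H) - β • S j) *
          (((m : ℂ) + 1) • (1 : H →L[ℂ] H) - β • S j) -
        star ((((m : ℂ) + 1) * β) • P - S j.rev) * ((((m : ℂ) + 1) * β) • P - S j.rev) = 0 := by
  have hc : ((m + 1 : ℕ) : ℂ) = (m : ℂ) + 1 := by push_cast; ring
  have hiso : Isometry P ↔ star P * P = 1 :=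
    (AddMonoidHomClass.isometry_iff_norm P).trans (norm_map_iff_adjoint_comp_self P)
  rw [← hc, hiso]
  constructor
  · rintro ⟨hP, hSr⟩ j β hβ
    rw [pencil_expansion _ _ _ _ hβ, hP]
    have h1 : star (S j.rev) * P - S j = 0 := sub_eq_zero.mpr (hSr j).symm
    have h2 : star (S j) * S j = star (S j.rev) * S j.rev := by
      have h3 : star (S j) = star P * S j.rev := by
        conv_lhs => rw [hSr j, ← star_eq_adjoint, star_mul, star_star]
      have h4 : star (S j.rev) = star P * S j := by
        conv_lhs => rw [hSr j.rev, Fin.rev_rev, ← star_eq_adjoint, star_mul, star_star]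
      rw [h3, h4, mul_assoc, mul_assoc, (hS _ _).eq]
    rw [h1, h2]
    simp
  · intro h
    have h1 : ∀ j, ((((m + 1 : ℕ) : ℂ) ^ 2) • (1 - star P * P) +
        (star (S j) * S j - star (S j.rev) * S j.rev)) = 0 ∧ star (S j.rev) * P - S j = 0 := by
      intro j
      refine fourier_eq_zero (Nat.succ_ne_zero m) fun β hβ => ?_
      rw [← pencil_expansion _ _ _ _ hβ]
      exact h j β hβ
    refine ⟨?_, fun j => (sub_eq_zero.mp (h1 j).2).symm⟩
    -- Adding the constant coefficients for an index and its reflection cancels the terms in `S` and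
    -- leaves `1 - P*P`.
    have h2 := (h1 ⟨0, hm⟩).1
    have h3 := (h1 (Fin.rev ⟨0, hm⟩)).1
    rw [Fin.rev_rev] at h3
    have h4 : (2 * ((m + 1 : ℕ) : ℂ) ^ 2) • (1 - star P * P) = 0 := by
      have := congrArg₂ (· + ·) h2 h3
      simp only [add_zero] at this
      rw [← this]
      module
    have h5 : (2 * ((m + 1 : ℕ) : ℂ) ^ 2) ≠ 0 :=
      mul_ne_zero two_ne_zero (pow_ne_zero _ (by exact_mod_cast Nat.succ_ne_zero m))
    exact (sub_eq_zero.mp ((smul_eq_zero.mp h4).resolve_left h5)).symm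

/-- The second factor of the pencil carries the unimodular scalar `ω^{n-i}`, which drops out, so
only `β = ω^i` matters; every `β` on the circle has such a root. -/
theorem pencilsVanish_iff {m : ℕ} (S : Fin m → H →L[ℂ] H) (P : H →L[ℂ] H) :
    PencilsVanish S P ↔ ∀ j, ∀ β : ℂ, ‖β‖ = 1 →
      star (((m : ℂ) + 1) • (1 : H →L[ℂ] H) - β • S j) *
          (((m : ℂ) + 1) • (1 : H →L[ℂ] H) - β • S j) -
        star ((((m : ℂ) + 1) * β) • P - S j.rev) * ((((m : ℂ) + 1) * β) • P - S j.rev) = 0 := by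
  have key : ∀ (ω : ℂ), ‖ω‖ = 1 → ∀ j : Fin m,
      pencil (fun k => ω ^ ((k : ℕ) + 1) • S k) (ω ^ (m + 1) • P) j =
      star (((m : ℂ) + 1) • (1 : H →L[ℂ] H) - ω ^ ((j : ℕ) + 1) • S j) *
          (((m : ℂ) + 1) • (1 : H →L[ℂ] H) - ω ^ ((j : ℕ) + 1) • S j) -
        star ((((m : ℂ) + 1) * ω ^ ((j : ℕ) + 1)) • P - S j.rev) *
          ((((m : ℂ) + 1) * ω ^ ((j : ℕ) + 1)) • P - S j.rev) := by
    intro ω hω j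
    rw [pencil]
    congr 1
    have h1 : m + 1 = ((j.rev : ℕ) + 1) + ((j : ℕ) + 1) := by rw [Fin.val_rev]; omega
    have h2 : ((m : ℂ) + 1) • ω ^ (m + 1) • P - ω ^ ((j.rev : ℕ) + 1) • S j.rev =
        ω ^ ((j.rev : ℕ) + 1) • ((((m : ℂ) + 1) * ω ^ ((j : ℕ) + 1)) • P - S j.rev) := by
      have h3 : ω ^ (m + 1) = ω ^ ((j.rev : ℕ) + 1) * ω ^ ((j : ℕ) + 1) := by
        rw [← pow_add, ← h1]
      rw [h3]
      module
    have h4 : star (ω ^ ((j.rev : ℕ) + 1)) * ω ^ ((j.rev : ℕ) + 1) = 1 := by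
      refine (Complex.conj_mul' _).trans ?_
      simp [hω]
    rw [h2, star_smul, smul_mul_smul_comm, h4, one_smul]
  constructor
  · intro h j β hβ
    obtain ⟨ω, hω⟩ := IsAlgClosed.exists_pow_nat_eq β (Nat.succ_pos (j : ℕ))
    have hn : ‖ω‖ = 1 := by
      rw [← hω, norm_pow] at hβ
      exact (pow_eq_one_iff_of_nonneg (norm_nonneg _) (Nat.succ_ne_zero _)).mp hβ
    have := h ω hn j
    rw [key ω hn j] at this
    rw [← hω]
    exact this
  · intro h ω hω j
    rw [key ω hω j]
    exact h j _ (by rw [norm_pow, hω, one_pow])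

/-- The isometry condition is `B*B = A*A` conjugated by the inverse of `A`. -/
theorem isometry_mul_inverse_iff {A B : H →L[ℂ] H} (hA : IsUnit A) :
    Isometry (B * Ring.inverse A) ↔ star A * A - star B * B = 0 := by
  have hiso : ∀ C : H →L[ℂ] H, Isometry C ↔ star C * C = 1 := fun C =>
    (AddMonoidHomClass.isometry_iff_norm C).trans (norm_map_iff_adjoint_comp_self C)
  obtain ⟨u, rfl⟩ := hA
  have h1 : star (u : H →L[ℂ] H) * star (↑u⁻¹ : H →L[ℂ] H) = 1 := by
    rw [← star_mul, Units.inv_mul, star_one]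
  have h2 : star (↑u⁻¹ : H →L[ℂ] H) * star (u : H →L[ℂ] H) = 1 := by
    rw [← star_mul, Units.mul_inv, star_one]
  rw [hiso, Ring.inverse_unit, sub_eq_zero, star_mul]
  constructor
  · intro h
    calc star (u : H →L[ℂ] H) * u
        = star (u : H →L[ℂ] H) * (star (↑u⁻¹ : H →L[ℂ] H) * star B * (B * ↑u⁻¹)) * u := by
          rw [h, mul_one]
      _ = (star (u : H →L[ℂ] H) * star (↑u⁻¹ : H →L[ℂ] H)) * star B * B * (↑u⁻¹ * u) := by
          simp only [mul_assoc]
      _ = star B * B := by rw [h1, Units.inv_mul, one_mul, mul_one]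
  · intro h
    calc star (↑u⁻¹ : H →L[ℂ] H) * star B * (B * ↑u⁻¹)
        = star (↑u⁻¹ : H →L[ℂ] H) * (star B * B) * ↑u⁻¹ := by simp only [mul_assoc]
      _ = (star (↑u⁻¹ : H →L[ℂ] H) * star (u : H →L[ℂ] H)) * (u * ↑u⁻¹) := by
          rw [← h]; simp only [mul_assoc]
      _ = 1 := by rw [h2, Units.mul_inv, mul_one]

end

section
variable {H : Type u} [NormedAddCommGroup H] [InnerProductSpace ℂ H]

theorem isUnit_of_spectralRadius_lt {m : ℕ} {S : H →L[ℂ] H}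
    (h : spectralRadius ℂ S < (m : ENNReal) + 1) {β : ℂ} (hβ : ‖β‖ = 1) :
    IsUnit (((m : ℂ) + 1) • (1 : H →L[ℂ] H) - β • S) := by
  have hβ0 : β ≠ 0 := by
    rintro rfl
    simp at hβ
  have h1 : spectralRadius ℂ S < ‖β⁻¹ * ((m : ℂ) + 1)‖₊ := by
    have : ‖β⁻¹ * ((m : ℂ) + 1)‖₊ = (m : NNReal) + 1 := by
      refine NNReal.eq ?_
      rw [coe_nnnorm, norm_mul, norm_inv, hβ]
      have : ((m : ℂ) + 1) = ((m + 1 : ℕ) : ℂ) := by push_cast; ring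
      rw [this, Complex.norm_natCast]
      simp
    rw [this]
    simpa using h
  have h2 := spectrum.mem_resolventSet_of_spectralRadius_lt h1
  rw [spectrum.mem_resolventSet_iff, Algebra.algebraMap_eq_smul_one] at h2
  have h3 : ((m : ℂ) + 1) • (1 : H →L[ℂ] H) - β • S =
      (Units.mk0 β hβ0) • ((β⁻¹ * ((m : ℂ) + 1)) • (1 : H →L[ℂ] H) - S) := by
    rw [Units.smul_def, Units.val_mk0, smul_sub, smul_smul, mul_inv_cancel_left₀ hβ0]
  rw [h3]
  exact h2.smul _

end

end

/-! ### The Wold decomposition. -/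

section

open ContinuousLinearMap

section
variable {H : Type u} [NormedAddCommGroup H] [InnerProductSpace ℂ H]

theorem restrict_joinTuple {m : ℕ} {S : Fin m → H →L[ℂ] H} {P : H →L[ℂ] H} {G : Submodule ℂ H}
    (h : ∀ i, Set.MapsTo (joinTuple S P i) G G) (hS : ∀ j, Set.MapsTo (S j) G G)
    (hP : Set.MapsTo P G G) :
    (fun i => (joinTuple S P i).restrict (h i)) =
      joinTuple (fun j => (S j).restrict (hS j)) (P.restrict hP) := by
  funext i
  refine ContinuousLinearMap.ext fun x => Subtype.ext ?_
  induction i using Fin.lastCases with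
  | last =>
    exact (congrArg (fun A : H →L[ℂ] H => A (x : H)) (joinTuple_last S P)).trans
      (congrArg (fun A : G →L[ℂ] G => ((A x : G) : H))
        (joinTuple_last (fun j => (S j).restrict (hS j)) (P.restrict hP)).symm)
  | cast j =>
    exact (congrArg (fun A : H →L[ℂ] H => A (x : H)) (joinTuple_castSucc S P j)).trans
      (congrArg (fun A : G →L[ℂ] G => ((A x : G) : H))
        (joinTuple_castSucc (fun j => (S j).restrict (hS j)) (P.restrict hP) j).symm)

theorem commute_restrict {A B : H →L[ℂ] H} {G : Submodule ℂ H} (hA : Set.MapsTo A G G)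
    (hB : Set.MapsTo B G G) (h : Commute A B) : Commute (A.restrict hA) (B.restrict hB) :=
  ContinuousLinearMap.ext fun x => Subtype.ext
    (congrArg (fun C : H →L[ℂ] H => C (x : H)) h.eq)

theorem IsGamIsometry.restrict {n : ℕ} {T : Fin n → H →L[ℂ] H} (h : IsGamIsometry T)
    {G : Submodule ℂ H} (hG : ∀ i, Set.MapsTo (T i) G G) :
    IsGamIsometry (fun i => (T i).restrict (hG i)) := by
  obtain ⟨K, _, _, _, V, N, hN, hV⟩ := h
  exact ⟨K, _, _, _, V.comp G.subtypeₗᵢ, N, hN, fun i x => hV i x⟩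

theorem isometry_restrict {P : H →L[ℂ] H} {G : Submodule ℂ H} (hG : Set.MapsTo P G G)
    (hP : Isometry P) : Isometry (P.restrict hG) :=
  Isometry.of_dist_eq fun x y => hP.dist_eq x y

theorem norm_add_sq_of_mem_orthogonal {G : Submodule ℂ H} {x y : H} (hx : x ∈ G) (hy : y ∈ Gᗮ) :
    ‖x + y‖ ^ 2 = ‖x‖ ^ 2 + ‖y‖ ^ 2 := by
  rw [sq, sq, sq, norm_add_sq_eq_norm_sq_add_norm_sq_of_inner_eq_zero x y
    ((Submodule.mem_orthogonal G y).mp hy x hx)]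

theorem inner_add_add_of_mem_orthogonal {G : Submodule ℂ H} {x y x' y' : H} (hx : x ∈ G)
    (hy : y ∈ Gᗮ) (hx' : x' ∈ G) (hy' : y' ∈ Gᗮ) :
    inner ℂ (x + y) (x' + y') = inner ℂ x x' + inner ℂ y y' := by
  rw [inner_add_left, inner_add_right, inner_add_right,
    (Submodule.mem_orthogonal G y').mp hy' x hx, (Submodule.mem_orthogonal' G y).mp hy x' hx']
  ring

theorem IsGamUnitary.isGamIsometry [CompleteSpace H] {n : ℕ} {T : Fin n → H →L[ℂ] H}
    (h : IsGamUnitary T) : IsGamIsometry T :=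
  ⟨H, _, _, inferInstance, LinearIsometry.id, T, h, fun _ _ => rfl⟩

end

section
variable {H : Type u} [NormedAddCommGroup H] [InnerProductSpace ℂ H] [CompleteSpace H]

/-- The space of the unitary part of an isometry. -/
def unitaryPart (P : H →L[ℂ] H) : Submodule ℂ H where
  carrier := {x | ∀ k : ℕ, (P ^ k) ((adjoint P ^ k) x) = x}
  add_mem' := fun {x y} hx hy k => by rw [map_add, map_add, hx k, hy k]
  zero_mem' := fun k => by rw [map_zero, map_zero]
  smul_mem' := fun c x hx k => by rw [map_smul, map_smul, hx k]

theorem mem_unitaryPart {P : H →L[ℂ] H} {x : H} :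
    x ∈ unitaryPart P ↔ ∀ k : ℕ, (P ^ k) ((adjoint P ^ k) x) = x := Iff.rfl

theorem isClosed_unitaryPart (P : H →L[ℂ] H) : IsClosed (unitaryPart P : Set H) := by
  have : (unitaryPart P : Set H) = ⋂ k : ℕ, {x | (P ^ k) ((adjoint P ^ k) x) = x} := by
    ext x
    simp [mem_unitaryPart]
  rw [this]
  exact isClosed_iInter fun k => isClosed_eq (by fun_prop) (by fun_prop)

theorem adjoint_apply_self {P : H →L[ℂ] H} (hP : Isometry P) (x : H) : adjoint P (P x) = x :=
  congrArg (fun A : H →L[ℂ] H => A x)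
    ((norm_map_iff_adjoint_comp_self P).mp ((AddMonoidHomClass.isometry_iff_norm P).mp hP))

theorem adjoint_pow_apply_self {P : H →L[ℂ] H} (hP : Isometry P) (k : ℕ) (x : H) :
    (adjoint P ^ k) ((P ^ k) x) = x := by
  induction k generalizing x with
  | zero => rfl
  | succ k ih =>
    rw [pow_succ, pow_succ', mul_apply_eq_comp, mul_apply_eq_comp, adjoint_apply_self hP, ih]

/-- Membership means lying in the range of every `P ^ k`, and operators commuting with `P` preserve
these ranges. -/
theorem mapsTo_unitaryPart {P : H →L[ℂ] H} (hP : Isometry P) {A : H →L[ℂ] H} (hA : Commute A P) :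
    Set.MapsTo A (unitaryPart P) (unitaryPart P) := by
  intro x hx k
  have h1 : A x = (P ^ k) (A ((adjoint P ^ k) x)) := by
    conv_lhs => rw [← mem_unitaryPart.mp hx k]
    exact congrArg (fun B : H →L[ℂ] H => B ((adjoint P ^ k) x)) (hA.pow_right k).eq
  rw [h1, adjoint_pow_apply_self hP]

theorem mapsTo_adjoint_unitaryPart {P : H →L[ℂ] H} (hP : Isometry P) :
    Set.MapsTo (adjoint P) (unitaryPart P) (unitaryPart P) := by
  intro x hx k
  have h1 : adjoint P x = (P ^ k) ((adjoint P ^ k) (adjoint P x)) := by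
    conv_lhs => rw [← mem_unitaryPart.mp hx (k + 1), pow_succ', mul_apply_eq_comp,
      adjoint_apply_self hP, pow_succ, mul_apply_eq_comp]
  exact h1.symm

theorem mapsTo_orthogonal {A : H →L[ℂ] H} {G : Submodule ℂ H} (h : Set.MapsTo (adjoint A) G G) :
    Set.MapsTo A Gᗮ Gᗮ := by
  intro x hx
  refine (Submodule.mem_orthogonal G _).mpr fun y hy => ?_
  rw [← adjoint_inner_left]
  exact (Submodule.mem_orthogonal G x).mp hx _ (h hy)

theorem norm_adjoint_pow_le {P : H →L[ℂ] H} (hP : Isometry P) (k : ℕ) (x : H) :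
    ‖(adjoint P ^ k) x‖ ≤ ‖x‖ := by
  have h1 : ‖adjoint P‖ ≤ 1 := by
    rw [LinearIsometryEquiv.norm_map]
    refine opNorm_le_bound _ zero_le_one fun y => ?_
    rw [(AddMonoidHomClass.isometry_iff_norm P).mp hP, one_mul]
  induction k with
  | zero => rfl
  | succ k ih =>
    rw [pow_succ', mul_apply_eq_comp]
    refine (le_of_opNorm_le _ h1 _).trans ?_
    rwa [one_mul]

/-- The vector `y - P^k P*^k y` lies in the kernel of `P*^k`, so a vector orthogonal to all these
kernels belongs to the unitary part. The complement of the unitary part is therefore in the closure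
of their increasing union, where convergence is clear; contractivity of `P*^k` extends it to the
closure. -/
theorem tendsto_adjoint_pow {P : H →L[ℂ] H} (hP : Isometry P) {x : H} (hx : x ∈ (unitaryPart P)ᗮ) :
    Filter.Tendsto (fun k : ℕ => (adjoint P ^ k) x) Filter.atTop (nhds 0) := by
  set U : ℕ → Submodule ℂ H := fun k => LinearMap.ker (adjoint P ^ k).toLinearMap with hU
  have hmono : Monotone U := by
    refine monotone_nat_of_le_succ fun k x hx => ?_
    rw [hU, LinearMap.mem_ker] at hx ⊢
    change (adjoint P ^ (k + 1)) x = 0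
    rw [pow_succ', mul_apply_eq_comp]
    exact (congrArg _ hx).trans (map_zero _)
  have hle : (⨆ k, U k)ᗮ ≤ unitaryPart P := by
    intro y hy k
    set w := y - (P ^ k) ((adjoint P ^ k) y) with hw
    have hwk : (adjoint P ^ k) w = 0 := by
      rw [hw, map_sub, adjoint_pow_apply_self hP, sub_self]
    have h1 : inner ℂ w y = 0 :=
      (Submodule.mem_orthogonal _ y).mp hy w (Submodule.mem_iSup_of_mem k hwk)
    have h2 : inner ℂ w ((P ^ k) ((adjoint P ^ k) y)) = 0 := by
      rw [← adjoint_inner_left, ← star_eq_adjoint, star_pow, star_eq_adjoint, hwk, inner_zero_left]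
    have h3 : inner ℂ w w = 0 := by
      conv_lhs => rw [hw]
      rw [← hw]
      conv_lhs => arg 3; rw [hw]
      rw [inner_sub_right, h1, h2, sub_zero]
    rw [inner_self_eq_zero, hw, sub_eq_zero] at h3
    exact h3.symm
  have hx' : x ∈ (⨆ k, U k).topologicalClosure := by
    rw [← Submodule.orthogonal_orthogonal_eq_closure]
    exact Submodule.orthogonal_le hle hx
  rw [Metric.tendsto_atTop]
  intro ε hε
  obtain ⟨w, hw, hxw⟩ := Metric.mem_closure_iff.mp hx' ε hε
  obtain ⟨K, hK⟩ := (Submodule.mem_iSup_of_directed U hmono.directed_le).mp hw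
  refine ⟨K, fun k hk => ?_⟩
  have h0 : (adjoint P ^ k) w = 0 := hmono hk hK
  rw [dist_zero_right]
  calc ‖(adjoint P ^ k) x‖ = ‖(adjoint P ^ k) (x - w)‖ := by rw [map_sub, h0, sub_zero]
    _ ≤ ‖x - w‖ := norm_adjoint_pow_le hP k _
    _ < ε := by rwa [← dist_eq_norm]

theorem adjoint_restrict_apply {A : H →L[ℂ] H} {G : Submodule ℂ H} [CompleteSpace G]
    (hA : Set.MapsTo A G G) (hA' : Set.MapsTo (adjoint A) G G) (x : G) :
    adjoint (A.restrict hA) x = (adjoint A).restrict hA' x := by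
  refine ext_inner_right ℂ fun y => ?_
  rw [adjoint_inner_left]
  exact (adjoint_inner_left A (y : H) (x : H)).symm

theorem eq_adjoint_mul_restrict {A B P : H →L[ℂ] H} {G : Submodule ℂ H} [CompleteSpace G]
    (hA : Set.MapsTo A G G) (hB : Set.MapsTo B G G) (hP : Set.MapsTo P G G)
    (h : A = adjoint B * P) :
    A.restrict hA = adjoint (B.restrict hB) * P.restrict hP := by
  refine ContinuousLinearMap.ext fun x => ext_inner_right ℂ fun y => ?_
  rw [mul_apply_eq_comp, adjoint_inner_left]
  change inner ℂ (A x) (y : H) = inner ℂ (P x) (B y)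
  rw [h, mul_apply_eq_comp, adjoint_inner_left]

/-- The Wold decomposition of a `Γ_n`-isometry. -/
theorem IsGamIsometry.hasWoldDecomposition {m : ℕ} {S : Fin m → H →L[ℂ] H} {P : H →L[ℂ] H}
    (hS : ∀ i j, Commute (S i) (S j)) (hSP : ∀ i, Commute (S i) P)
    (h : IsGamIsometry (joinTuple S P)) : HasWoldDecomposition (joinTuple S P) := by
  obtain ⟨hP, hSr, hsc, -⟩ := h.properties hS hSP
  set G := unitaryPart P with hG
  have hc : CompleteSpace G := (isClosed_unitaryPart P).completeSpace_coe
  have hGP : Set.MapsTo P G G := mapsTo_unitaryPart hP (Commute.refl P)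
  have hGP' : Set.MapsTo (adjoint P) G G := mapsTo_adjoint_unitaryPart hP
  have hGS : ∀ j, Set.MapsTo (S j) G G := fun j => mapsTo_unitaryPart hP (hSP j)
  -- The relations enter here: they make the unitary part of `P`, chosen without regard to `S`,
  -- reducing for every `S j`.
  have hGS' : ∀ j, Set.MapsTo (adjoint (S j)) G G := fun j => by
    have h1 : adjoint (S j) = adjoint P * S j.rev := by
      conv_lhs => rw [hSr j, ← star_eq_adjoint, star_mul, star_eq_adjoint, star_eq_adjoint,
        adjoint_adjoint]
    rw [h1]
    exact fun x hx => hGP' (hGS _ hx)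
  have h₁ : ∀ i, Set.MapsTo (joinTuple S P i) G G := fun i => by
    induction i using Fin.lastCases with
    | last => rwa [joinTuple_last]
    | cast j => rw [joinTuple_castSucc]; exact hGS j
  have h₂ : ∀ i, Set.MapsTo (joinTuple S P i) Gᗮ Gᗮ := fun i => by
    induction i using Fin.lastCases with
    | last => rw [joinTuple_last]; exact mapsTo_orthogonal hGP'
    | cast j => rw [joinTuple_castSucc]; exact mapsTo_orthogonal (hGS' j)
  refine ⟨G, hc, h₁, h₂, ?_, h.restrict h₂, ?_, ?_⟩
  · rw [restrict_joinTuple h₁ hGS hGP]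
    have e1 : adjoint (P.restrict hGP) * P.restrict hGP = 1 :=
      (norm_map_iff_adjoint_comp_self _).mp
        ((AddMonoidHomClass.isometry_iff_norm _).mp (isometry_restrict hGP hP))
    refine isGamUnitary_joinTuple (fun i j => commute_restrict _ _ (hS i j))
      (fun i => commute_restrict _ _ (hSP i)) e1 ?_
      (fun j => eq_adjoint_mul_restrict _ _ _ (hSr j)) ?_
    · refine ContinuousLinearMap.ext fun x => Subtype.ext ?_
      rw [mul_apply_eq_comp, adjoint_restrict_apply hGP hGP']
      have := mem_unitaryPart.mp x.2 1
      rw [pow_one, pow_one] at this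
      exact this
    · refine PolyBounded.of_intertwine (Gam_nonempty m) (commute_scaledTuple hS)
        (commute_scaledTuple fun i j => commute_restrict _ _ (hS i j)) G.subtypeₗᵢ
        (fun i x => rfl) (hsc.2.polyBounded (Gam_nonempty m))
  · have := isometry_restrict (h₂ (Fin.last m)) (by rwa [joinTuple_last])
    exact this
  · intro x
    have hG2 : Set.MapsTo (adjoint P) Gᗮ Gᗮ := mapsTo_orthogonal (by rwa [adjoint_adjoint])
    have hl : Set.MapsTo (adjoint (joinTuple S P (Fin.last m))) Gᗮ Gᗮ := by rwa [joinTuple_last]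
    have e : ∀ k : ℕ, (((adjoint ((joinTuple S P (Fin.last m)).restrict (h₂ (Fin.last m))) ^ k) x :
        Gᗮ) : H) = (adjoint P ^ k) x := by
      intro k
      induction k with
      | zero => rfl
      | succ k ih =>
        rw [pow_succ', pow_succ', mul_apply_eq_comp, mul_apply_eq_comp, ← ih,
          adjoint_restrict_apply _ hl]
        exact congrArg (fun A : H →L[ℂ] H => adjoint A _) (joinTuple_last S P)
    rw [tendsto_subtype_rng]
    simp_rw [e]
    exact tendsto_adjoint_pow hP x.2

/-- No direct sum of extensions is built: both summands satisfy condition 2, which is checked on `H`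
componentwise. -/
theorem isGamIsometry_of_hasWoldDecomposition {m : ℕ} {S : Fin m → H →L[ℂ] H} {P : H →L[ℂ] H}
    (hS : ∀ i j, Commute (S i) (S j)) (hSP : ∀ i, Commute (S i) P)
    (h : HasWoldDecomposition (joinTuple S P)) : IsGamIsometry (joinTuple S P) := by
  obtain ⟨G, hc, h₁, h₂, hu, hp, -⟩ := h
  have g1 := hu.isGamIsometry
  have hP₁ : Set.MapsTo P G G := by simpa using h₁ (Fin.last m)
  have hP₂ : Set.MapsTo P Gᗮ Gᗮ := by simpa using h₂ (Fin.last m)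
  have hS₁ : ∀ j, Set.MapsTo (S j) G G := fun j => by simpa using h₁ j.castSucc
  have hS₂ : ∀ j, Set.MapsTo (S j) Gᗮ Gᗮ := fun j => by simpa using h₂ j.castSucc
  rw [restrict_joinTuple h₁ hS₁ hP₁] at g1
  rw [restrict_joinTuple h₂ hS₂ hP₂] at hp
  have c₁ := fun i j => commute_restrict (hS₁ i) (hS₁ j) (hS i j)
  have c₂ := fun i j => commute_restrict (hS₂ i) (hS₂ j) (hS i j)
  obtain ⟨i₁, r₁, s₁, -⟩ := g1.properties c₁ fun i => commute_restrict _ _ (hSP i)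
  obtain ⟨i₂, r₂, s₂, -⟩ := hp.properties c₂ fun i => commute_restrict _ _ (hSP i)
  have dec : ∀ x : H, ∃ y ∈ G, ∃ z ∈ Gᗮ, x = y + z := G.exists_add_mem_mem_orthogonal
  refine isGamIsometry_of_polyBounded hS hSP ?_ ?_ ?_
  · refine (AddMonoidHomClass.isometry_iff_norm P).mpr fun x => ?_
    obtain ⟨y, hy, z, hz, rfl⟩ := dec x
    rw [← sq_eq_sq₀ (norm_nonneg _) (norm_nonneg _), map_add,
      norm_add_sq_of_mem_orthogonal (hP₁ hy) (hP₂ hz), norm_add_sq_of_mem_orthogonal hy hz]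
    have e1 : ‖P y‖ = ‖y‖ := (AddMonoidHomClass.isometry_iff_norm _).mp i₁ ⟨y, hy⟩
    have e2 : ‖P z‖ = ‖z‖ := (AddMonoidHomClass.isometry_iff_norm _).mp i₂ ⟨z, hz⟩
    rw [e1, e2]
  · intro j
    refine ContinuousLinearMap.ext fun x => ext_inner_right ℂ fun x' => ?_
    rw [mul_apply_eq_comp, adjoint_inner_left]
    obtain ⟨y, hy, z, hz, rfl⟩ := dec x
    obtain ⟨y', hy', z', hz', rfl⟩ := dec x'
    rw [map_add, map_add, map_add,
      inner_add_add_of_mem_orthogonal (hS₁ j hy) (hS₂ j hz) hy' hz',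
      inner_add_add_of_mem_orthogonal (hP₁ hy) (hP₂ hz) (hS₁ _ hy') (hS₂ _ hz')]
    have e1 : inner ℂ (S j y) y' = inner ℂ (P y) (S j.rev y') := by
      have := congrArg (fun A : G →L[ℂ] G => inner ℂ (A ⟨y, hy⟩) (⟨y', hy'⟩ : G)) (r₁ j)
      simp only [mul_apply_eq_comp, adjoint_inner_left] at this
      exact this
    have e2 : inner ℂ (S j z) z' = inner ℂ (P z) (S j.rev z') := by
      have := congrArg (fun A : Gᗮ →L[ℂ] Gᗮ => inner ℂ (A ⟨z, hz⟩) (⟨z', hz'⟩ : Gᗮ)) (r₂ j)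
      simp only [mul_apply_eq_comp, adjoint_inner_left] at this
      exact this
    rw [e1, e2]
  -- The polynomial acts on the orthogonal components separately, so the bounds add in squares.
  · intro p M hM
    have b₁ := s₁.2.polyBounded (Gam_nonempty m) p M hM
    have b₂ := s₂.2.polyBounded (Gam_nonempty m) p M hM
    have hM0 : 0 ≤ M := (norm_nonneg _).trans b₁
    refine opNorm_le_bound _ hM0 fun x => ?_
    obtain ⟨y, hy, z, hz, rfl⟩ := dec x
    have e1 := polyEval_intertwine (commute_scaledTuple c₁) (commute_scaledTuple hS) G.subtype
      (fun i x => rfl) p ⟨y, hy⟩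
    have e2 := polyEval_intertwine (commute_scaledTuple c₂) (commute_scaledTuple hS) Gᗮ.subtype
      (fun i x => rfl) p ⟨z, hz⟩
    have n1 := le_of_opNorm_le _ b₁ ⟨y, hy⟩
    have n2 := le_of_opNorm_le _ b₂ ⟨z, hz⟩
    rw [← sq_le_sq₀ (norm_nonneg _) (by positivity), mul_pow, map_add,
      norm_add_sq_of_mem_orthogonal hy hz]
    simp only [Submodule.subtype_apply] at e1 e2
    rw [e1, e2, norm_add_sq_of_mem_orthogonal (Subtype.coe_prop _) (Subtype.coe_prop _), mul_add,
      ← mul_pow, ← mul_pow]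
    exact add_le_add (pow_le_pow_left₀ (norm_nonneg _) n1 2) (pow_le_pow_left₀ (norm_nonneg _) n2 2)

end

end

end SymPolydisc

end

/-! ### Assembly of the equivalences. -/

theorem mainTheorem5 {H : Type*} [NormedAddCommGroup H] [InnerProductSpace ℂ H] [CompleteSpace H]
    (m : ℕ) (hm : 1 ≤ m) (S : Fin m → H →L[ℂ] H) (P : H →L[ℂ] H)
    (hS : ∀ i j, Commute (S i) (S j)) (hSP : ∀ i, Commute (S i) P) :
    List.TFAE
      [ SymPolydisc.IsGamIsometry (SymPolydisc.joinTuple S P),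
        Isometry P ∧ (∀ j, S j = ContinuousLinearMap.adjoint (S j.rev) * P) ∧
          SymPolydisc.IsGamContraction (SymPolydisc.scaledTuple S),
        SymPolydisc.HasWoldDecomposition (SymPolydisc.joinTuple S P),
        SymPolydisc.IsGamContraction (SymPolydisc.joinTuple S P) ∧ Isometry P,
        SymPolydisc.IsGamContraction (SymPolydisc.scaledTuple S) ∧
          SymPolydisc.PencilsVanish S P ] ∧
    ((∀ j, spectralRadius ℂ (S j) < (m : ENNReal) + 1) →
      (SymPolydisc.IsGamIsometry (SymPolydisc.joinTuple S P) ↔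
        SymPolydisc.IsGamContraction (SymPolydisc.scaledTuple S) ∧
          ∀ j, ∀ β : ℂ, ‖β‖ = 1 →
            Isometry (((((m : ℂ) + 1) * β) • P - S j.rev) *
              Ring.inverse (((m : ℂ) + 1) • (1 : H →L[ℂ] H) - β • S j)))) := by
  have h12 : SymPolydisc.IsGamIsometry (SymPolydisc.joinTuple S P) ↔
      Isometry P ∧ (∀ j, S j = ContinuousLinearMap.adjoint (S j.rev) * P) ∧
        SymPolydisc.IsGamContraction (SymPolydisc.scaledTuple S) := by
    constructor
    · intro h
      obtain ⟨h1, h2, h3, -⟩ := h.properties hS hSP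
      exact ⟨h1, h2, h3⟩
    · rintro ⟨h1, h2, h3⟩
      exact SymPolydisc.isGamIsometry_of_polyBounded hS hSP h1 h2
        (h3.2.polyBounded (SymPolydisc.Gam_nonempty m))
  constructor
  · tfae_have 1 ↔ 2 := h12
    tfae_have 1 → 3 := fun h => h.hasWoldDecomposition hS hSP
    tfae_have 3 → 1 := SymPolydisc.isGamIsometry_of_hasWoldDecomposition hS hSP
    tfae_have 1 → 4 := fun h => ⟨(h.properties hS hSP).2.2.2, (h.properties hS hSP).1⟩
    tfae_have 4 → 1 := fun ⟨h, hP⟩ => by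
      have hb := h.2.polyBounded (SymPolydisc.Gam_nonempty (m + 1))
      exact SymPolydisc.isGamIsometry_of_polyBounded hS hSP hP
        (SymPolydisc.eq_adjoint_mul_of_polyBounded hS hSP hP hb)
        (SymPolydisc.polyBounded_scaledTuple hS hSP hb)
    tfae_have 2 ↔ 5 := by
      rw [SymPolydisc.pencilsVanish_iff, ← SymPolydisc.relations_iff_pencil hm hS]
      tauto
    tfae_finish
  · intro hr
    rw [h12, ← and_assoc, SymPolydisc.relations_iff_pencil hm hS, and_comm]
    refine and_congr_right fun _ => forall_congr' fun j => forall_congr' fun β =>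
      forall_congr' fun hβ => ?_
    -- The spectral radius condition makes `n - β S_i` invertible on the whole circle, so the
    -- isometry condition is the vanishing of the pencil at `β`.
    exact (SymPolydisc.isometry_mul_inverse_iff
      (SymPolydisc.isUnit_of_spectralRadius_lt (hr j) hβ)).symm
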